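/- Let $\mathbb k$ be a field of characteristic zero. Consider all pairs $(A,\Delta)$, where $A$ is a $\mathbb Z$-graded associative (not necessarily unital) $\mathbb k$-algebra and $\Delta:A\to A$ is a linear map of degree $+1$ with $\Delta^2=0$ ($\Delta$ need not be a derivation). A natural operation of arity $k\ge 1$ is a family of linear maps $\beta_A:A^{\otimes k}\to A$, indexed by all such pairs, which is a linear combination of composites of the identity, the multiplication, the differential $\Delta$ and permutations of the inputs, with the Koszul sign convention; it has degree $q$ if $\Delta$ occurs $q$ times in each composite. An $A_\infty$-algebra is a graded vector space $A$ with degree $+1$ linear maps $m_k:A^{\otimes k}\to A$, $k\ge1$, such that $$\sum_{k+l=n+1}\ \sum_{1\le i\le k} m_k\big(\mathrm{id}^{\otimes (i-1)}\otimes m_l\otimes \mathrm{id}^{\otimes (k-i)}\big)=0\qquad\text{for all } n\ge 1 .$$ A natural $A_\infty$-algebra is a family of $A_\infty$-algebras $(A,m_1,m_2,\dots)$, one for each pair $(A,\Delta)$, such that each $m_k$ is a natural operation of degree $1$. Let $T^cA=\bigoplus_{n\ge1}A^{\otimes n}$ be the tensor coalgebra with the deconcatenation coproduct, $\pi:T^cA\to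 A$ the projection, and write an automorphism $\phi$ of the coalgebra $T^cA$ as $\phi=(\phi_1,\phi_2,\dots)$ with components $\phi_k=\pi\phi|_{A^{\otimes k}}$. A natural automorphism is a family of automorphisms $\phi$ of $T^cA$, one for each pair $(A,\Delta)$, such that each $\phi_k$ is a natural operation of degree $0$. Denote again by $\Delta$ the coderivation $\sum_i \mathrm{id}^{\otimes(i-1)}\otimes\Delta\otimes\mathrm{id}^{\otimes(n-i)}$ (on $A^{\otimes n}$) of $T^cA$, which represents the trivial $A_\infty$-algebra $(A,\Delta,0,0,\dots)$. Theorem. For each natural $A_\infty$-algebra $(A,m_1,m_2,m_3,\dots)$ with $m_1=\Delta$ there exists a unique natural automorphism $\phi=(\mathrm{id}_A,\phi_2,\phi_3,\dots)$ of $T^cA$ such that $(A,m_1,m_2,\dots)$ is the twisting of $(A,\Delta,0,0,\dots)$ by $\phi$, that is, $$m_k(a_1,\dots,a_k)=\pi\,\phi^{-1}\Delta\,\phi(a_1\otimes\cdots\otimes a_k)\qquad\text{for all } k\ge1,\ a_1,\dots,a_k\in A .$$ Moreover, $$m_2(a_1,a_2)=\Delta(a_1a_2)-(-1)^{|a_1|}a_1\Delta(a_2)-\Delta(a_1)a_2$$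 holds for all $(A,\Delta)$ and all $a_1,a_2\in A$ (with $a_1$ homogeneous) if and only if $\phi_2(a,b)=ab$ for all $(A,\Delta)$ and all $a,b\in A$. -/

import Mathlib

open scoped TensorProduct DirectSum

universe u v

noncomputable section

namespace NatBraces

/-- A `ℤ`-graded associative (not necessarily unital) algebra over `k`, together with a differential
`Δ`, that is, a linear map of degree `+1` with `Δ ∘ Δ = 0`. It is not assumed that `Δ` is a
derivation. -/
structure DeltaAlg (k : Type u) [Field k] : Type (max u (v + 1)) where
  carrier : Type v
  [ring : NonUnitalRing carrier]
  [module : Module k carrier]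
  [scalarTower : IsScalarTower k carrier carrier]
  [smulComm : SMulCommClass k carrier carrier]
  /-- the homogeneous parts -/
  deg : ℤ → Submodule k carrier
  [decomp : DirectSum.Decomposition deg]
  mul_mem : ∀ {i j : ℤ} {a b : carrier}, a ∈ deg i → b ∈ deg j → a * b ∈ deg (i + j)
  /-- the differential -/
  Δ : carrier →ₗ[k] carrier
  Δ_mem : ∀ {i : ℤ} {a : carrier}, a ∈ deg i → Δ a ∈ deg (i + 1)
  Δ_sq : ∀ a : carrier, Δ (Δ a) = 0

attribute [instance] DeltaAlg.ring DeltaAlg.module DeltaAlg.scalarTower DeltaAlg.smulComm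
  DeltaAlg.decomp

variable {k : Type u} [Field k]

instance : CoeSort (DeltaAlg.{u, v} k) (Type v) := ⟨DeltaAlg.carrier⟩

/-- The parity involution of a graded vector space, `a ↦ (-1)^{|a|} a` on homogeneous elements. -/
def parity (A : DeltaAlg.{u, v} k) : A →ₗ[k] A :=
  (DirectSum.toModule k ℤ A (fun i => (i.negOnePow : ℤ) • (A.deg i).subtype)) ∘ₗ
    (DirectSum.decomposeLinearEquiv A.deg).toLinearMap

theorem parity_of_mem (A : DeltaAlg.{u, v} k) {i : ℤ} {a : A} (ha : a ∈ A.deg i) :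
    parity A a = (i.negOnePow : ℤ) • a := by
  have h : DirectSum.decompose A.deg a = DirectSum.lof k ℤ (fun i => A.deg i) i ⟨a, ha⟩ :=
    DirectSum.decompose_of_mem A.deg ha
  simp only [parity, LinearMap.comp_apply, LinearEquiv.coe_coe,
    DirectSum.decomposeLinearEquiv_apply, h, DirectSum.toModule_lof]
  rfl

/-- The linear maps from the `(n + 1)`-st tensor power of `A` to `A`, as multilinear maps. -/
abbrev Mult (A : DeltaAlg.{u, v} k) (n : ℕ) : Type v :=
  MultilinearMap k (fun _ : Fin (n + 1) => (A : Type v)) A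

/-! ### Compositions and `A∞`-algebras -/

/-- The arguments of `f` in the composition `f (id ⊗ ⋯ ⊗ id ⊗ g ⊗ id ⊗ ⋯ ⊗ id)`, where `g`, an
operation of degree `q` with `l + 1` inputs, is plugged into the input number `i` (counted from `0`)
of an operation `f` with `p + 1` inputs. With the Koszul sign convention, these are
`((-1)^{q|a₀|} a₀, …, (-1)^{q|aᵢ₋₁|} aᵢ₋₁, g (aᵢ, …, aᵢ₊ₗ), aᵢ₊ₗ₊₁, …)`. -/
def insertArgs (A : DeltaAlg.{u, v} k) {n p l : ℕ} (h : p + l = n) (q : ℕ) (g : Mult A l)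
    (i : Fin (p + 1)) (a : Fin (n + 1) → A) : Fin (p + 1) → A := fun x =>
  if x < i then (parity A ^ q) (a ⟨x, by omega⟩)
  else if x = i then g (fun y => a ⟨i + y, by omega⟩)
  else a ⟨x + l, by omega⟩

/-- `(A, m₁, m₂, …)` is an `A∞`-algebra (in the desuspended convention, in which all structure
operations have degree `+1`). The operation `m n` has `n + 1` inputs. -/
structure IsAInfinity (A : DeltaAlg.{u, v} k) (m : ∀ n : ℕ, Mult A n) : Prop where
  degree : ∀ (n : ℕ) (d : Fin (n + 1) → ℤ) (a : Fin (n + 1) → A), (∀ i, a i ∈ A.deg (d i)) →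
    m n a ∈ A.deg ((∑ i, d i) + 1)
  axioms : ∀ (n : ℕ) (a : Fin (n + 1) → A),
    ∑ r : Finset.HasAntidiagonal.antidiagonal n, ∑ i : Fin (r.1.1 + 1),
      m r.1.1 (insertArgs A (Finset.HasAntidiagonal.mem_antidiagonal.1 r.2) 1 (m r.1.2) i a) = 0

/-! ### Natural operations -/

/-- The Koszul sign `ε(σ; w₁, …, wₙ)` for elements `wᵢ` of degrees `d i`, that is, the sign in
`w₁ ∧ ⋯ ∧ wₙ = ε • w_{σ(1)} ∧ ⋯ ∧ w_{σ(n)}`. -/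
def koszulSign {n : ℕ} (σ : Equiv.Perm (Fin n)) (d : Fin n → ℤ) : ℤˣ :=
  ∏ i, ∏ j, if i < j ∧ σ j < σ i then (d (σ i) * d (σ j)).negOnePow else 1

/-- Families of linear maps from the `(n + 1)`-st tensor power of `A` to `A`, indexed by all graded
associative algebras `A` with a differential. -/
abbrev OpFamily (k : Type u) [Field k] (n : ℕ) : Type (max u (v + 1)) :=
  ∀ A : DeltaAlg.{u, v} k, Mult A n

/-- `IsNatural n q β`: the family `β` is a natural operation with `n + 1` inputs and of degree `q`,
that is, a linear combination of composites of the elementary operations: the identity, the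
differential, the multiplication and permutations of inputs (with Koszul signs). -/
inductive IsNatural : ∀ n : ℕ, ℕ → OpFamily.{u, v} k n → Prop
  | ident (β : OpFamily.{u, v} k 0) (hβ : ∀ A a, β A a = a 0) : IsNatural 0 0 β
  | differential (β : OpFamily.{u, v} k 0) (hβ : ∀ A a, β A a = A.Δ (a 0)) : IsNatural 0 1 β
  | product (β : OpFamily.{u, v} k 1) (hβ : ∀ A a, β A a = a 0 * a 1) : IsNatural 1 0 β
  | comp {n p l q r : ℕ} (h : p + l = n) (i : Fin (p + 1))
      (f : OpFamily.{u, v} k p) (g : OpFamily.{u, v} k l) (β : OpFamily.{u, v} k n)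
      (hf : IsNatural p r f) (hg : IsNatural l q g)
      (hβ : ∀ A a, β A a = f A (insertArgs A h q (g A) i a)) : IsNatural n (r + q) β
  | perm {n q : ℕ} (σ : Equiv.Perm (Fin (n + 1))) (f β : OpFamily.{u, v} k n)
      (hf : IsNatural n q f)
      (hβ : ∀ (A : DeltaAlg.{u, v} k) (d : Fin (n + 1) → ℤ) (a : Fin (n + 1) → A),
        (∀ i, a i ∈ A.deg (d i)) → β A a = (koszulSign σ d : ℤ) • f A (fun i => a (σ i))) :
      IsNatural n q β
  | zero (n q : ℕ) : IsNatural n q 0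
  | add {n q : ℕ} (f g : OpFamily.{u, v} k n) (hf : IsNatural n q f) (hg : IsNatural n q g) :
      IsNatural n q (f + g)
  | smul {n q : ℕ} (c : k) (f : OpFamily.{u, v} k n) (hf : IsNatural n q f) :
      IsNatural n q (c • f)

/-- A natural `A∞`-algebra: a family of `A∞`-algebras `(A, m₁, m₂, …)` on all graded associative
algebras with a differential, whose structure operations are natural operations of degree `1`. -/
structure IsNaturalAInfinity (m : ∀ n : ℕ, OpFamily.{u, v} k n) : Prop where
  natural : ∀ n, IsNatural n 1 (m n)
  aInfinity : ∀ A, IsAInfinity A (fun n => m n A)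

/-! ### The tensor coalgebra -/

/-- The space `⨁_{n ≥ 1} A^{⊗ n}`; the summand with index `n` is `A^{⊗ (n + 1)}`. -/
abbrev Tc (A : DeltaAlg.{u, v} k) : Type (max u v) :=
  ⨁ n : ℕ, ⨂[k] (_ : Fin (n + 1)), (A : Type v)

/-- The word `a₀ ⊗ ⋯ ⊗ aₙ`, as a multilinear map to the tensor coalgebra. -/
def word (A : DeltaAlg.{u, v} k) (n : ℕ) :
    MultilinearMap k (fun _ : Fin (n + 1) => (A : Type v)) (Tc A) :=
  (DirectSum.lof k ℕ (fun n => ⨂[k] (_ : Fin (n + 1)), (A : Type v)) n).compMultilinearMap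
    (PiTensorProduct.tprod k)

/-- The deconcatenation coproduct,
`a₀ ⊗ ⋯ ⊗ aₙ ↦ ∑_{i < n} (a₀ ⊗ ⋯ ⊗ aᵢ) ⊗ (aᵢ₊₁ ⊗ ⋯ ⊗ aₙ)`. -/
def deconc (A : DeltaAlg.{u, v} k) : Tc A →ₗ[k] Tc A ⊗[k] Tc A :=
  DirectSum.toModule k ℕ _ fun n => PiTensorProduct.lift <|
    ∑ i : Fin n, ((word A i).domCoprod (word A (n - 1 - i))).domDomCongr
      (finSumFinEquiv.trans (finCongr (by omega)))

/-- The canonical projection of the tensor coalgebra to `A`. -/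
def proj (A : DeltaAlg.{u, v} k) : Tc A →ₗ[k] A :=
  (PiTensorProduct.subsingletonEquiv (R := k) (0 : Fin 1)).toLinearMap ∘ₗ
    DirectSum.component k ℕ (fun n => ⨂[k] (_ : Fin (n + 1)), (A : Type v)) 0

/-- The component of an endomorphism of the tensor coalgebra with `n + 1` inputs. -/
def component {A : DeltaAlg.{u, v} k} (θ : Tc A →ₗ[k] Tc A) (n : ℕ) : Mult A n :=
  (proj A ∘ₗ θ).compMultilinearMap (word A n)

/-- The linear coderivation `(Δ, 0, 0, …)` of the tensor coalgebra, which represents the trivial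
`A∞`-algebra `(A, Δ, 0, 0, …)`; on words it is given by
`a₀ ⊗ ⋯ ⊗ aₙ ↦ ∑ᵢ (-1)^{|a₀| + ⋯ + |aᵢ₋₁|} a₀ ⊗ ⋯ ⊗ Δ aᵢ ⊗ ⋯ ⊗ aₙ`. -/
def trivialCoder (A : DeltaAlg.{u, v} k) : Tc A →ₗ[k] Tc A :=
  DirectSum.toModule k ℕ _ fun n =>
    DirectSum.lof k ℕ (fun n => ⨂[k] (_ : Fin (n + 1)), (A : Type v)) n ∘ₗ
      ∑ i : Fin (n + 1), PiTensorProduct.map fun j : Fin (n + 1) =>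
        if j < i then parity A else if j = i then A.Δ else LinearMap.id

/-- The twisting `φ⁻¹ θ φ` of a coderivation `θ` by an automorphism `φ`. -/
def twist {A : DeltaAlg.{u, v} k} (φ : Tc A ≃ₗ[k] Tc A) (θ : Tc A →ₗ[k] Tc A) :
    Tc A →ₗ[k] Tc A :=
  φ.symm.toLinearMap ∘ₗ θ ∘ₗ φ.toLinearMap

/-- A natural automorphism `φ = (id, φ₂, φ₃, …)`: a family of automorphisms of the tensor coalgebras
of all graded associative algebras with a differential, whose components are natural operations of
degree `0`, the first one being the identity. -/
structure IsNaturalAut (φ : ∀ A : DeltaAlg.{u, v} k, Tc A ≃ₗ[k] Tc A) : Prop where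
  coalg : ∀ A, deconc A ∘ₗ (φ A).toLinearMap =
    TensorProduct.map (φ A).toLinearMap (φ A).toLinearMap ∘ₗ deconc A
  natural : ∀ n, IsNatural n 0 (fun A => component (φ A).toLinearMap n)
  component_zero : ∀ A a, component (φ A).toLinearMap 0 a = a 0

end NatBraces

end

/-!
A coalgebra morphism `φ` of the tensor coalgebra intertwines the coderivation `M` with components
`m₁ = Δ, m₂, …` with `Δ` if and only if `∑ φ_p (id ⊗ m_l ⊗ id) = Δ φ_n` for every number `n` of
inputs (`twist_iff`). Separating the summands with `p = n`, that is, `l = 1`, this reads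
`δ φ_n = R_n`, where `δ β` is `Δ β - β Δ` in degree `0` and `Δ β + β Δ` in degree `1`, and `R_n`
(`lowerSum`) involves only the `φ_p` with `p < n`. So the theorem says that these equations have
exactly one solution in natural operations, which is a statement about the complex of natural
operations with a fixed number of inputs and the differential `δ`.

For at least two inputs this complex is contractible. A natural operation `β` is uniquely of the
form `Δ β₁ + β₂`, where both `β₁` and `β₂` are linear combinations of composites whose outermost
operation is a product. The map `h β = β₁` satisfies `h (Δ β) = β₂` and `h (β Δ) = (h β) Δ`, so it
is a contracting homotopy; in degree `0` it vanishes. To see without a basis of free algebras that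
`β₁` and `β₂` are well defined, each algebra `A` is extended to `A ⊕ A ⊕ A[-1]` with the product
`(a, f, s) (a', f', s') = (a a', a a', 0)` and the differential `Δ (a, f, s) = (Δ a, 0, f)`
(`extAlg`). The values of `β` on this extension are `(β, β₂, β₁)`, and they depend only on the
first coordinates of the inputs (`IsNatural.apply_inl_fst`). So `β₂` (`prodPart`) and `β₁`
(`diffPart`) can be read off, and their properties follow by induction on the construction of `β`.

Hence a solution must be `φ_n = h R_n`, and this recursion defines `autComp`. It is a solution: if
the equations with fewer inputs hold, then `δ` vanishes on the defect `R_n - δ φ_n`, as `M` and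
`Δ` square to zero (`outerDiff_defect_add`), and `h` vanishes on it by the choice of `φ_n`, so the
defect is zero (`defect_autComp`). With two inputs `R` is `m₂`, and `m₂ = δ μ` for the
multiplication `μ` if and only if `φ₂ = h δ μ = μ`.

On the side of coalgebras, morphisms and coderivations of the tensor coalgebra are determined by
their projection to `A` and can be prescribed freely (`coext`, `coder`): a word is recovered from
its letter part and from the first letters in its deconcatenation, which leads to fixed point
equations that can be solved by recursion on the length of words (`exists_fixed`, `eq_of_fixed`).
-/

noncomputable section

namespace NatBraces

variable {k : Type u} [Field k]

/-! ### Words in the tensor coalgebra -/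

theorem word_congr (A : DeltaAlg.{u, v} k) {n n' : ℕ} (h : n = n') {a : Fin (n + 1) → A}
    {b : Fin (n' + 1) → A} (hab : ∀ j : Fin (n + 1), a j = b ⟨j, by omega⟩) :
    word A n a = word A n' b := by
  subst h
  exact congrArg _ (funext hab)

theorem cons_mk_of_eq_zero {α : Type*} {n m : ℕ} (a : α) (b : Fin n → α) (h : m < n + 1)
    (e : m = 0) : (Fin.cons a b : Fin (n + 1) → α) ⟨m, h⟩ = a := by
  subst e
  rfl

theorem cons_mk_of_eq_succ {α : Type*} {n m m' : ℕ} (a : α) (b : Fin n → α) (h : m < n + 1)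
    (h' : m' < n) (e : m = m' + 1) : (Fin.cons a b : Fin (n + 1) → α) ⟨m, h⟩ = b ⟨m', h'⟩ := by
  subst e
  rfl

/-- Linear maps on the tensor coalgebra are determined by their values on words. -/
theorem Tc.hom_ext {A : DeltaAlg.{u, v} k} {X : Type*} [AddCommGroup X] [Module k X]
    {f g : Tc A →ₗ[k] X} (h : ∀ n a, f (word A n a) = g (word A n a)) : f = g := by
  refine DirectSum.linearMap_ext k fun n => PiTensorProduct.ext ?_
  ext a
  exact h n a

/-- The inclusion of `A` into the tensor coalgebra, as words with one letter. -/
def single (A : DeltaAlg.{u, v} k) : A →ₗ[k] Tc A :=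
  (MultilinearMap.ofSubsingleton k (A : Type v) (Tc A) (0 : Fin 1)).symm (word A 0)

theorem single_apply (A : DeltaAlg.{u, v} k) (a : A) : single A a = word A 0 (fun _ => a) := rfl

theorem word_zero (A : DeltaAlg.{u, v} k) (a : Fin 1 → A) : word A 0 a = single A (a 0) := by
  rw [single_apply]
  exact congrArg _ (funext fun i => by rw [Subsingleton.elim i 0])

/-- Prepending a letter to a word: `a ⊗ (a₀ ⊗ ⋯ ⊗ aₙ) ↦ a ⊗ a₀ ⊗ ⋯ ⊗ aₙ`. -/
def prepend (A : DeltaAlg.{u, v} k) : (A : Type v) ⊗[k] Tc A →ₗ[k] Tc A :=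
  TensorProduct.lift <| LinearMap.flip <| DirectSum.toModule k ℕ _ fun n =>
    (PiTensorProduct.lift.toLinearMap ∘ₗ (word A (n + 1)).curryLeft).flip

theorem prepend_word (A : DeltaAlg.{u, v} k) (n : ℕ) (a : A) (b : Fin (n + 1) → A) :
    prepend A (a ⊗ₜ word A n b) = word A (n + 1) (Fin.cons a b) := by
  simp only [prepend, TensorProduct.lift.tmul, LinearMap.flip_apply]
  rw [word, LinearMap.compMultilinearMap_apply, DirectSum.toModule_lof]
  simp [PiTensorProduct.lift.tprod]

theorem word_succ (A : DeltaAlg.{u, v} k) (n : ℕ) (a : Fin (n + 2) → A) :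
    word A (n + 1) a = prepend A (a 0 ⊗ₜ word A n (Fin.tail a)) := by
  rw [prepend_word, Fin.cons_self_tail]

theorem proj_single (A : DeltaAlg.{u, v} k) (a : A) : proj A (single A a) = a := by
  rw [single_apply, word, LinearMap.compMultilinearMap_apply, proj, LinearMap.comp_apply,
    DirectSum.component.lof_self]
  exact PiTensorProduct.subsingletonEquiv_apply_tprod _ _

theorem proj_prepend (A : DeltaAlg.{u, v} k) (x : (A : Type v) ⊗[k] Tc A) :
    proj A (prepend A x) = 0 := by
  have : proj A ∘ₗ prepend A = 0 := by
    refine TensorProduct.ext (LinearMap.ext fun a => Tc.hom_ext fun n b => ?_)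
    simp only [TensorProduct.mk_apply, LinearMap.comp_apply,
      prepend_word, LinearMap.zero_apply, LinearMap.compr₂ₛₗ_apply]
    rw [word, LinearMap.compMultilinearMap_apply, proj, LinearMap.comp_apply,
      DirectSum.component.of, dif_neg (by omega), map_zero]
  exact LinearMap.congr_fun this x

theorem deconc_word (A : DeltaAlg.{u, v} k) (n : ℕ) (a : Fin (n + 1) → A) :
    deconc A (word A n a) = ∑ i : Fin n,
      word A i (fun j => a ⟨j, by omega⟩) ⊗ₜ[k]
        word A (n - 1 - i) (fun j => a ⟨i + 1 + j, by omega⟩) := by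
  rw [deconc, word, LinearMap.compMultilinearMap_apply, DirectSum.toModule_lof,
    PiTensorProduct.lift.tprod, sum_apply]
  refine Finset.sum_congr rfl fun i _ => ?_
  rfl

theorem deconc_single (A : DeltaAlg.{u, v} k) (a : A) : deconc A (single A a) = 0 := by
  rw [single_apply, deconc_word]
  rfl

/-- Prepending a letter to the first factor of a tensor product of words. -/
def prependLeft (A : DeltaAlg.{u, v} k) :
    (A : Type v) ⊗[k] (Tc A ⊗[k] Tc A) →ₗ[k] Tc A ⊗[k] Tc A :=
  TensorProduct.map (prepend A) LinearMap.id ∘ₗ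
    (TensorProduct.assoc k (A : Type v) (Tc A) (Tc A)).symm.toLinearMap

@[simp]
theorem prependLeft_tmul (A : DeltaAlg.{u, v} k) (a : A) (s t : Tc A) :
    prependLeft A (a ⊗ₜ (s ⊗ₜ t)) = prepend A (a ⊗ₜ s) ⊗ₜ t := rfl

theorem map_prependLeft_eq_zero {A : DeltaAlg.{u, v} k} {X Y : Type*} [AddCommGroup X] [Module k X]
    [AddCommGroup Y] [Module k Y] (f : A →ₗ[k] Y) (ψ : Tc A →ₗ[k] X)
    (x : (A : Type v) ⊗[k] (Tc A ⊗[k] Tc A)) :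
    TensorProduct.map (f ∘ₗ proj A) ψ (prependLeft A x) = 0 := by
  have : TensorProduct.map (f ∘ₗ proj A) ψ ∘ₗ prependLeft A = 0 :=
    TensorProduct.ext (LinearMap.ext fun a => TensorProduct.ext' fun s t => by
      simp [proj_prepend])
  exact LinearMap.congr_fun this x

theorem deconc_prepend_tmul (A : DeltaAlg.{u, v} k) (a : A) (t : Tc A) :
    deconc A (prepend A (a ⊗ₜ t)) = single A a ⊗ₜ t + prependLeft A (a ⊗ₜ deconc A t) := by
  suffices h : deconc A ∘ₗ prepend A ∘ₗ TensorProduct.mk k (A : Type v) (Tc A) a =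
      TensorProduct.mk k (Tc A) (Tc A) (single A a) +
        prependLeft A ∘ₗ TensorProduct.mk k (A : Type v) (Tc A ⊗[k] Tc A) a ∘ₗ deconc A from
    LinearMap.congr_fun h t
  refine Tc.hom_ext (X := Tc A ⊗[k] Tc A) fun n b => ?_
  simp only [LinearMap.comp_apply, TensorProduct.mk_apply, LinearMap.add_apply, prepend_word,
    deconc_word, map_sum, prependLeft_tmul]
  rw [Fin.sum_univ_succ]
  congr 1
  · rw [single_apply]
    refine congrArg₂ _ (congrArg _ (funext fun j => ?_)) (congrArg _ (funext fun j => ?_))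
    · have hj : (j : ℕ) = 0 := by have := j.2; simp at this; omega
      exact cons_mk_of_eq_zero a b _ hj
    · exact cons_mk_of_eq_succ a b _ _ (by simp; omega)
  · refine Finset.sum_congr rfl fun i _ => congrArg₂ _ ?_ ?_
    · refine congrArg _ (funext fun j => ?_)
      refine Fin.cases rfl (fun j => ?_) j
      rfl
    · refine word_congr A (by simp; omega) fun j => ?_
      exact cons_mk_of_eq_succ a b _ _ (by simp; omega)

/-- The tensor coalgebra is generated by the words with one letter under prepending letters. -/
theorem Tc.induction {A : DeltaAlg.{u, v} k} {X : Type*} [AddCommGroup X] [Module k X]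
    {f g : Tc A →ₗ[k] X} (h₀ : ∀ a, f (single A a) = g (single A a))
    (h₁ : ∀ a t, f t = g t → f (prepend A (a ⊗ₜ t)) = g (prepend A (a ⊗ₜ t))) : f = g := by
  refine Tc.hom_ext fun n => ?_
  induction n with
  | zero => exact fun a => by rw [word_zero, h₀]
  | succ n ih => exact fun a => by rw [word_succ]; exact h₁ _ _ (ih _)

/-- An element of the tensor coalgebra is recovered from its letter part and from the first letters
in its deconcatenation. -/
theorem eq_single_add_prepend (A : DeltaAlg.{u, v} k) (t : Tc A) :
    t = single A (proj A t) + prepend A (TensorProduct.map (proj A) LinearMap.id (deconc A t)) := by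
  suffices h : LinearMap.id = single A ∘ₗ proj A +
      prepend A ∘ₗ TensorProduct.map (proj A) (LinearMap.id : Tc A →ₗ[k] Tc A) ∘ₗ deconc A from
    LinearMap.congr_fun h t
  refine Tc.induction (fun a => ?_) fun a t _ => ?_
  · simp [proj_single, deconc_single]
  · have := map_prependLeft_eq_zero LinearMap.id (LinearMap.id : Tc A →ₗ[k] Tc A)
      (a ⊗ₜ deconc A t)
    rw [LinearMap.id_comp] at this
    simp [proj_prepend, deconc_prepend_tmul, this, proj_single]

theorem deconc_comp_prepend (A : DeltaAlg.{u, v} k) :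
    deconc A ∘ₗ prepend A = TensorProduct.map (single A) LinearMap.id +
      prependLeft A ∘ₗ TensorProduct.map LinearMap.id (deconc A) :=
  TensorProduct.ext' fun a t => deconc_prepend_tmul A a t

theorem deconc_coassoc (A : DeltaAlg.{u, v} k) :
    (TensorProduct.assoc k (Tc A) (Tc A) (Tc A)).toLinearMap ∘ₗ
        TensorProduct.map (deconc A) LinearMap.id ∘ₗ deconc A =
      TensorProduct.map LinearMap.id (deconc A) ∘ₗ deconc A := by
  -- the two auxiliary identities describe both sides on `prependLeft A (a ⊗ x)`
  have key₁ : ∀ a x, TensorProduct.map LinearMap.id (deconc A) (prependLeft A (a ⊗ₜ x)) =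
      TensorProduct.map (prepend A ∘ₗ TensorProduct.mk k (A : Type v) _ a) LinearMap.id
        (TensorProduct.map LinearMap.id (deconc A) x) := fun a x => by
    induction x with
    | zero => simp
    | add x y hx hy => simp only [TensorProduct.tmul_add, map_add, hx, hy]
    | tmul s t => simp
  have key₂ : ∀ a x, (TensorProduct.assoc k (Tc A) (Tc A) (Tc A))
      (TensorProduct.map (deconc A) LinearMap.id (prependLeft A (a ⊗ₜ x))) =
      single A a ⊗ₜ x +
      TensorProduct.map (prepend A ∘ₗ TensorProduct.mk k (A : Type v) _ a) LinearMap.id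
        (TensorProduct.assoc k (Tc A) (Tc A) (Tc A)
          (TensorProduct.map (deconc A) LinearMap.id x)) := fun a x => by
    induction x with
    | zero => simp
    | add x y hx hy =>
      simp only [TensorProduct.tmul_add, map_add, hx, hy]
      abel
    | tmul s t =>
      simp only [prependLeft_tmul, TensorProduct.map_tmul, deconc_prepend_tmul,
        TensorProduct.add_tmul, map_add, TensorProduct.assoc_tmul, LinearMap.id_apply]
      congr 1
      induction deconc A s with
      | zero => simp
      | add x y hx hy => simp only [TensorProduct.tmul_add, TensorProduct.add_tmul, map_add, hx, hy]
      | tmul s t => simp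
  refine Tc.induction (X := Tc A ⊗[k] (Tc A ⊗[k] Tc A)) (fun a => ?_) fun a t ih => ?_
  · simp [deconc_single]
  · simp only [LinearMap.comp_apply, LinearEquiv.coe_coe] at ih ⊢
    simp [deconc_prepend_tmul, key₁, key₂, ih, deconc_single]

/-! ### Recursion on the length of words -/

/-- The linear map `f` vanishes on the words with at most `n` letters. -/
def VanishesBelow {A : DeltaAlg.{u, v} k} {X : Type*} [AddCommGroup X] [Module k X]
    (f : Tc A →ₗ[k] X) (n : ℕ) : Prop :=
  ∀ j < n, ∀ a, f (word A j a) = 0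

section Contracting

variable {A : DeltaAlg.{u, v} k} {X : Type*} [AddCommGroup X] [Module k X]

theorem VanishesBelow.eq_zero {f : Tc A →ₗ[k] X} (h : ∀ n, VanishesBelow f n) : f = 0 :=
  Tc.hom_ext fun n a => h (n + 1) n n.lt_succ_self a

theorem VanishesBelow.sub {f g : Tc A →ₗ[k] X} {n : ℕ} (hf : VanishesBelow f n)
    (hg : VanishesBelow g n) : VanishesBelow (f - g) n := fun j hj a => by
  rw [LinearMap.sub_apply, hf j hj, hg j hj, sub_zero]

variable {L : (Tc A →ₗ[k] X) →ₗ[k] (Tc A →ₗ[k] X)}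

theorem eq_zero_of_fixed (hL : ∀ f n, VanishesBelow f n → VanishesBelow (L f) (n + 1))
    {f : Tc A →ₗ[k] X} (hf : f = L f) : f = 0 := by
  refine VanishesBelow.eq_zero fun n => ?_
  induction n with
  | zero => exact fun j hj => absurd hj (by omega)
  | succ n ih => rw [hf]; exact hL _ _ ih

theorem eq_of_fixed (hL : ∀ f n, VanishesBelow f n → VanishesBelow (L f) (n + 1))
    {B f g : Tc A →ₗ[k] X} (hf : f = B + L f) (hg : g = B + L g) : f = g := by
  refine sub_eq_zero.1 (eq_zero_of_fixed hL ?_)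
  rw [map_sub]
  nth_rw 1 [hf, hg]
  abel

/-- The approximations `K⁰ 0, K¹ 0, …` with `K f = B + L f` stabilise on each word. -/
theorem exists_fixed (hL : ∀ f n, VanishesBelow f n → VanishesBelow (L f) (n + 1))
    (B : Tc A →ₗ[k] X) : ∃ f, f = B + L f := by
  let K : (Tc A →ₗ[k] X) → (Tc A →ₗ[k] X) := fun f => B + L f
  have hK : ∀ f g n, VanishesBelow (f - g) n → VanishesBelow (K f - K g) (n + 1) := by
    intro f g n h
    have : K f - K g = L (f - g) := by simp [K]
    rw [this]
    exact hL _ _ h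
  let ψ : ℕ → (Tc A →ₗ[k] X) := fun r => K^[r] 0
  have hψ : ∀ r, ψ (r + 1) = K (ψ r) := fun r => Function.iterate_succ_apply' K r 0
  have step : ∀ r, VanishesBelow (ψ (r + 1) - ψ r) r := by
    intro r
    induction r with
    | zero => exact fun j hj => absurd hj (by omega)
    | succ r ih => rw [hψ (r + 1), hψ r]; rw [hψ r] at ih; exact hK _ _ _ ih
  have stable : ∀ d j a, ψ (j + 1 + d) (word A j a) = ψ (j + 1) (word A j a) := by
    intro d j a
    induction d with
    | zero => rfl
    | succ d ih =>
      rw [← ih, ← sub_eq_zero, ← LinearMap.sub_apply]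
      exact step (j + 1 + d) j (by omega) a
  let φ : Tc A →ₗ[k] X := DirectSum.toModule k ℕ X fun n => ψ (n + 1) ∘ₗ
    DirectSum.lof k ℕ (fun n => ⨂[k] (_ : Fin (n + 1)), (A : Type v)) n
  have hφ : ∀ n a, φ (word A n a) = ψ (n + 1) (word A n a) := fun n a => by
    simp only [φ, word, LinearMap.compMultilinearMap_apply, DirectSum.toModule_lof,
      LinearMap.comp_apply]
  have close : ∀ r, VanishesBelow (φ - ψ r) r := by
    intro r j hj a
    obtain ⟨d, rfl⟩ : ∃ d, r = j + 1 + d := ⟨r - (j + 1), by omega⟩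
    rw [LinearMap.sub_apply, hφ, stable, sub_self]
  refine ⟨φ, sub_eq_zero.1 (VanishesBelow.eq_zero fun n => ?_)⟩
  have h₁ := hK _ _ _ (close n)
  rw [← hψ] at h₁
  intro j hj a
  have := (close (n + 1)).sub h₁ j (by omega) a
  simpa [K] using this

end Contracting

/-- The operator `ψ ↦ c ∘ (F ⊗ ψ) ∘ deconc`. As `ψ` is applied to proper final segments of words
only, it can serve for definitions by recursion on the length of words. -/
def recOp {A : DeltaAlg.{u, v} k} {X : Type*} [AddCommGroup X] [Module k X]
    (c : (A : Type v) ⊗[k] X →ₗ[k] X) (F : Tc A →ₗ[k] A) :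
    (Tc A →ₗ[k] X) →ₗ[k] (Tc A →ₗ[k] X) where
  toFun ψ := c ∘ₗ TensorProduct.map F ψ ∘ₗ deconc A
  map_add' ψ ψ' := by
    rw [TensorProduct.map_add_right, LinearMap.add_comp, LinearMap.comp_add]
  map_smul' r ψ := by
    rw [TensorProduct.map_smul_right, LinearMap.smul_comp, LinearMap.comp_smul]; rfl

theorem recOp_apply {A : DeltaAlg.{u, v} k} {X : Type*} [AddCommGroup X] [Module k X]
    (c : (A : Type v) ⊗[k] X →ₗ[k] X) (F : Tc A →ₗ[k] A) (ψ : Tc A →ₗ[k] X) :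
    recOp c F ψ = c ∘ₗ TensorProduct.map F ψ ∘ₗ deconc A := rfl

/-- The first factors in the coproduct of a word are not empty, so that the second factors are
strictly shorter than the word. -/
theorem recOp_contracting {A : DeltaAlg.{u, v} k} {X : Type*} [AddCommGroup X] [Module k X]
    (c : (A : Type v) ⊗[k] X →ₗ[k] X) (F : Tc A →ₗ[k] A) (ψ : Tc A →ₗ[k] X) (n : ℕ)
    (h : VanishesBelow ψ n) : VanishesBelow (recOp c F ψ) (n + 1) := by
  intro j hj a
  simp only [recOp_apply, LinearMap.comp_apply, deconc_word, map_sum, TensorProduct.map_tmul]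
  refine Finset.sum_eq_zero fun i _ => ?_
  rw [h _ (by omega), TensorProduct.tmul_zero, map_zero]

/-- An endomorphism `X` of the tensor coalgebra with `deconc ∘ X = (X ⊗ p + q ⊗ X) ∘ deconc` is
determined by `p`, `q` and its projection to `A`. -/
theorem eq_of_proj_comp_eq {A : DeltaAlg.{u, v} k} {X Y p q : Tc A →ₗ[k] Tc A}
    (hX : deconc A ∘ₗ X = (TensorProduct.map X p + TensorProduct.map q X) ∘ₗ deconc A)
    (hY : deconc A ∘ₗ Y = (TensorProduct.map Y p + TensorProduct.map q Y) ∘ₗ deconc A)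
    (h : proj A ∘ₗ X = proj A ∘ₗ Y) : X = Y := by
  have key : ∀ Z : Tc A →ₗ[k] Tc A,
      deconc A ∘ₗ Z = (TensorProduct.map Z p + TensorProduct.map q Z) ∘ₗ deconc A →
      Z = (single A ∘ₗ (proj A ∘ₗ Z) +
          prepend A ∘ₗ TensorProduct.map (proj A ∘ₗ Z) p ∘ₗ deconc A) +
        recOp (prepend A) (proj A ∘ₗ q) Z := by
    intro Z hZ
    refine LinearMap.ext fun t => ?_
    have h₁ : deconc A (Z t) = _ := LinearMap.congr_fun hZ t
    conv_lhs => rw [eq_single_add_prepend A (Z t), h₁, LinearMap.comp_apply, LinearMap.add_apply,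
      map_add, map_add, TensorProduct.map_map, TensorProduct.map_map, ← add_assoc]
    rfl
  have hX' := key X hX
  rw [h] at hX'
  exact eq_of_fixed (recOp_contracting _ _) hX' (key Y hY)

/-! ### Morphisms and coderivations of the tensor coalgebra -/

/-- Coassociativity, in the form in which it enters the recursions on the length of words. -/
theorem prependLeft_map_deconc {A : DeltaAlg.{u, v} k} (F : Tc A →ₗ[k] A) (ψ χ : Tc A →ₗ[k] Tc A)
    (t : Tc A) :
    prependLeft A (TensorProduct.map F (TensorProduct.map ψ χ ∘ₗ deconc A) (deconc A t)) =
      TensorProduct.map (prepend A ∘ₗ TensorProduct.map F ψ ∘ₗ deconc A) χ (deconc A t) := by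
  have h₁ : prependLeft A ∘ₗ TensorProduct.map F (TensorProduct.map ψ χ) ∘ₗ
      (TensorProduct.assoc k (Tc A) (Tc A) (Tc A)).toLinearMap =
        TensorProduct.map (prepend A ∘ₗ TensorProduct.map F ψ) χ :=
    TensorProduct.ext_threefold fun r s t => rfl
  have h₂ := LinearMap.congr_fun (deconc_coassoc A) t
  have h₃ := LinearMap.congr_fun h₁ (TensorProduct.map (deconc A) LinearMap.id (deconc A t))
  simp only [LinearMap.comp_apply, LinearEquiv.coe_coe] at h₂ h₃
  rw [h₂, TensorProduct.map_map, TensorProduct.map_map] at h₃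
  exact h₃

theorem deconc_prepend (A : DeltaAlg.{u, v} k) (x : (A : Type v) ⊗[k] Tc A) :
    deconc A (prepend A x) = TensorProduct.map (single A) LinearMap.id x +
      prependLeft A (TensorProduct.map LinearMap.id (deconc A) x) :=
  LinearMap.congr_fun (deconc_comp_prepend A) x

theorem exists_coext {A : DeltaAlg.{u, v} k} (F : Tc A →ₗ[k] A) :
    ∃ φ, φ = single A ∘ₗ F + recOp (prepend A) F φ :=
  exists_fixed (recOp_contracting _ _) _

/-- The endomorphism of the tensor coalgebra whose projection to `A` is `F`. -/
def coext {A : DeltaAlg.{u, v} k} (F : Tc A →ₗ[k] A) : Tc A →ₗ[k] Tc A := (exists_coext F).choose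

theorem coext_eq {A : DeltaAlg.{u, v} k} (F : Tc A →ₗ[k] A) :
    coext F = single A ∘ₗ F + recOp (prepend A) F (coext F) := (exists_coext F).choose_spec

theorem coext_apply {A : DeltaAlg.{u, v} k} (F : Tc A →ₗ[k] A) (t : Tc A) :
    coext F t = single A (F t) + prepend A (TensorProduct.map F (coext F) (deconc A t)) :=
  LinearMap.congr_fun (coext_eq F) t

theorem proj_coext {A : DeltaAlg.{u, v} k} (F : Tc A →ₗ[k] A) (t : Tc A) :
    proj A (coext F t) = F t := by
  rw [coext_apply, map_add, proj_single, proj_prepend, add_zero]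

theorem deconc_coext {A : DeltaAlg.{u, v} k} (F : Tc A →ₗ[k] A) :
    deconc A ∘ₗ coext F = TensorProduct.map (coext F) (coext F) ∘ₗ deconc A := by
  refine eq_of_fixed (X := Tc A ⊗[k] Tc A) (recOp_contracting (prependLeft A) F)
    (B := TensorProduct.map (single A ∘ₗ F) (coext F) ∘ₗ deconc A) ?_ ?_
  · refine LinearMap.ext fun t => ?_
    simp only [LinearMap.comp_apply, LinearMap.add_apply, recOp_apply]
    rw [coext_apply, map_add, deconc_single, deconc_prepend, TensorProduct.map_map,
      TensorProduct.map_map]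
    simp
  · refine LinearMap.ext fun t => ?_
    simp only [LinearMap.comp_apply, LinearMap.add_apply, recOp_apply]
    rw [prependLeft_map_deconc, ← LinearMap.add_apply, ← TensorProduct.map_add_left]
    congr 2
    exact coext_eq F

/-- Morphisms of the tensor coalgebra are determined by their projection to `A`. -/
theorem coalgHom_eq_coext {A : DeltaAlg.{u, v} k} {φ : Tc A →ₗ[k] Tc A}
    (hφ : deconc A ∘ₗ φ = TensorProduct.map φ φ ∘ₗ deconc A) : φ = coext (proj A ∘ₗ φ) := by
  refine eq_of_fixed (recOp_contracting (prepend A) (proj A ∘ₗ φ)) ?_ (coext_eq _)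
  refine LinearMap.ext fun t => ?_
  have h : deconc A (φ t) = _ := LinearMap.congr_fun hφ t
  conv_lhs => rw [eq_single_add_prepend A (φ t), h, LinearMap.comp_apply, TensorProduct.map_map]
  rfl

/-- The parity involution of the tensor coalgebra. -/
def parityTc (A : DeltaAlg.{u, v} k) : Tc A →ₗ[k] Tc A := coext (parity A ∘ₗ proj A)

theorem parityTc_prepend (A : DeltaAlg.{u, v} k) (a : A) (t : Tc A) :
    parityTc A (prepend A (a ⊗ₜ t)) = prepend A (parity A a ⊗ₜ parityTc A t) := by
  rw [parityTc, coext_apply, deconc_prepend_tmul, map_add, map_prependLeft_eq_zero]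
  simp [proj_prepend, proj_single]

theorem parityTc_single (A : DeltaAlg.{u, v} k) (a : A) :
    parityTc A (single A a) = single A (parity A a) := by
  rw [parityTc, coext_apply, deconc_single]
  simp [proj_single]

theorem parityTc_word (A : DeltaAlg.{u, v} k) (n : ℕ) (a : Fin (n + 1) → A) :
    parityTc A (word A n a) = word A n (fun i => parity A (a i)) := by
  induction n with
  | zero => rw [word_zero, word_zero, parityTc_single]
  | succ n ih => rw [word_succ, word_succ, parityTc_prepend, ih]; rfl

theorem exists_coder {A : DeltaAlg.{u, v} k} (m : Tc A →ₗ[k] A) :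
    ∃ M, M = (single A ∘ₗ m + prepend A ∘ₗ TensorProduct.map m LinearMap.id ∘ₗ deconc A) +
      recOp (prepend A) (parity A ∘ₗ proj A) M :=
  exists_fixed (recOp_contracting _ _) _

/-- The coderivation of degree `1` of the tensor coalgebra whose projection to `A` is `m`. -/
def coder {A : DeltaAlg.{u, v} k} (m : Tc A →ₗ[k] A) : Tc A →ₗ[k] Tc A := (exists_coder m).choose

theorem coder_eq {A : DeltaAlg.{u, v} k} (m : Tc A →ₗ[k] A) :
    coder m = (single A ∘ₗ m + prepend A ∘ₗ TensorProduct.map m LinearMap.id ∘ₗ deconc A) +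
      recOp (prepend A) (parity A ∘ₗ proj A) (coder m) := (exists_coder m).choose_spec

theorem coder_apply {A : DeltaAlg.{u, v} k} (m : Tc A →ₗ[k] A) (t : Tc A) :
    coder m t = single A (m t) + prepend A (TensorProduct.map m LinearMap.id (deconc A t)) +
      prepend A (TensorProduct.map (parity A ∘ₗ proj A) (coder m) (deconc A t)) :=
  LinearMap.congr_fun (coder_eq m) t

theorem proj_coder {A : DeltaAlg.{u, v} k} (m : Tc A →ₗ[k] A) (t : Tc A) :
    proj A (coder m t) = m t := by
  rw [coder_apply, map_add, map_add, proj_single, proj_prepend, proj_prepend, add_zero, add_zero]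

/-- The linear endomorphism `M` of the tensor coalgebra is a coderivation of odd degree. -/
def IsOddCoder {A : DeltaAlg.{u, v} k} (M : Tc A →ₗ[k] Tc A) : Prop :=
  deconc A ∘ₗ M =
    (TensorProduct.map M LinearMap.id + TensorProduct.map (parityTc A) M) ∘ₗ deconc A

theorem isOddCoder_coder {A : DeltaAlg.{u, v} k} (m : Tc A →ₗ[k] A) : IsOddCoder (coder m) := by
  refine eq_of_fixed (X := Tc A ⊗[k] Tc A)
    (recOp_contracting (prependLeft A) (parity A ∘ₗ proj A))
    (B := TensorProduct.map (single A ∘ₗ m) LinearMap.id ∘ₗ deconc A +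
      prependLeft A ∘ₗ TensorProduct.map m (deconc A) ∘ₗ deconc A +
      TensorProduct.map (single A ∘ₗ parity A ∘ₗ proj A) (coder m) ∘ₗ deconc A) ?_ ?_
  · refine LinearMap.ext fun t => ?_
    simp only [LinearMap.comp_apply, LinearMap.add_apply, recOp_apply]
    rw [coder_apply, map_add, map_add, deconc_single, deconc_prepend, deconc_prepend,
      TensorProduct.map_map, TensorProduct.map_map, TensorProduct.map_map, TensorProduct.map_map]
    simp only [LinearMap.id_comp, LinearMap.comp_id]
    abel
  · refine LinearMap.ext fun t => ?_
    have h₁ := prependLeft_map_deconc m LinearMap.id LinearMap.id t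
    rw [TensorProduct.map_id, LinearMap.id_comp] at h₁
    have h₂ : TensorProduct.map (coder m) LinearMap.id (deconc A t) = _ :=
      congrArg (fun f => TensorProduct.map f LinearMap.id (deconc A t)) (coder_eq m)
    have h₃ : TensorProduct.map (parityTc A) (coder m) (deconc A t) = _ :=
      congrArg (fun f => TensorProduct.map f (coder m) (deconc A t)) (coext_eq _)
    simp only [LinearMap.comp_apply, LinearMap.add_apply, recOp_apply, LinearMap.add_comp,
      map_add, TensorProduct.map_add_left, h₁,
      prependLeft_map_deconc] at h₂ h₃ ⊢
    rw [h₂, h₃]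
    simp only [parityTc]
    abel

theorem IsOddCoder.apply {A : DeltaAlg.{u, v} k} {M : Tc A →ₗ[k] Tc A} (hM : IsOddCoder M)
    (t : Tc A) : deconc A (M t) = TensorProduct.map M LinearMap.id (deconc A t) +
      TensorProduct.map (parityTc A) M (deconc A t) :=
  LinearMap.congr_fun hM t

theorem deconc_parityTc {A : DeltaAlg.{u, v} k} (t : Tc A) :
    deconc A (parityTc A t) = TensorProduct.map (parityTc A) (parityTc A) (deconc A t) :=
  LinearMap.congr_fun (deconc_coext _) t

/-- Odd coderivations are determined by their projection to `A`. -/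
theorem IsOddCoder.ext {A : DeltaAlg.{u, v} k} {M N : Tc A →ₗ[k] Tc A} (hM : IsOddCoder M)
    (hN : IsOddCoder N) (h : proj A ∘ₗ M = proj A ∘ₗ N) : M = N :=
  eq_of_proj_comp_eq hM hN h

/-- A coderivation whose projection to `A` anticommutes with the parity anticommutes with the
parity. -/
theorem IsOddCoder.parity_comm {A : DeltaAlg.{u, v} k} {M : Tc A →ₗ[k] Tc A} (hM : IsOddCoder M)
    (h : ∀ t, proj A (M (parityTc A t)) = -parity A (proj A (M t))) :
    M ∘ₗ parityTc A + parityTc A ∘ₗ M = 0 := by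
  refine eq_of_proj_comp_eq (p := parityTc A) (q := parityTc A ∘ₗ parityTc A) ?_ (by simp) ?_
  · refine LinearMap.ext fun t => ?_
    simp only [LinearMap.comp_apply, LinearMap.add_apply, map_add, hM.apply, deconc_parityTc,
      TensorProduct.map_add_left, TensorProduct.map_add_right, TensorProduct.map_map,
      LinearMap.id_comp, LinearMap.comp_id]
    abel
  · refine LinearMap.ext fun t => ?_
    change proj A (M (parityTc A t) + parityTc A (M t)) = proj A 0
    rw [map_add, h]
    simp [parityTc, proj_coext]

/-- The square of an odd coderivation is a coderivation, in which the mixed terms cancel as `M`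
anticommutes with the parity; so it vanishes if its projection to `A` does. -/
theorem IsOddCoder.comp_self {A : DeltaAlg.{u, v} k} {M : Tc A →ₗ[k] Tc A} (hM : IsOddCoder M)
    (h : ∀ t, proj A (M (parityTc A t)) = -parity A (proj A (M t)))
    (hsq : ∀ t, proj A (M (M t)) = 0) : M ∘ₗ M = 0 := by
  refine eq_of_proj_comp_eq (p := LinearMap.id) (q := parityTc A ∘ₗ parityTc A) ?_ (by simp)
    (LinearMap.ext fun t => by simpa using hsq t)
  refine LinearMap.ext fun t => ?_
  have h₀ : TensorProduct.map (M ∘ₗ parityTc A) M (deconc A t) +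
      TensorProduct.map (parityTc A ∘ₗ M) M (deconc A t) = 0 := by
    rw [← LinearMap.add_apply, ← TensorProduct.map_add_left, hM.parity_comm h]
    simp
  simp only [LinearMap.comp_apply, LinearMap.add_apply, map_add, hM.apply,
    TensorProduct.map_map, LinearMap.id_comp, LinearMap.comp_id]
  rw [← sub_eq_zero, ← h₀]
  abel

/-! ### Invertible morphisms -/

/-- The span of the words with at most `n` letters. -/
def shortWords (A : DeltaAlg.{u, v} k) (n : ℕ) : Submodule k (Tc A) :=
  Submodule.span k {t | ∃ j < n, ∃ a, t = word A j a}

theorem word_mem_shortWords {A : DeltaAlg.{u, v} k} {j n : ℕ} (h : j < n) (a : Fin (j + 1) → A) :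
    word A j a ∈ shortWords A n := Submodule.subset_span ⟨j, h, a, rfl⟩

theorem shortWords_mono (A : DeltaAlg.{u, v} k) {n n' : ℕ} (h : n ≤ n') :
    shortWords A n ≤ shortWords A n' :=
  Submodule.span_mono fun _ ⟨j, hj, a, ha⟩ => ⟨j, hj.trans_le h, a, ha⟩

theorem prepend_mem_shortWords {A : DeltaAlg.{u, v} k} {n : ℕ} (a : A) {t : Tc A}
    (ht : t ∈ shortWords A n) : prepend A (a ⊗ₜ t) ∈ shortWords A (n + 1) := by
  suffices h : shortWords A n ≤
      (shortWords A (n + 1)).comap (prepend A ∘ₗ TensorProduct.mk k (A : Type v) (Tc A) a) by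
    exact h ht
  refine Submodule.span_le.2 ?_
  rintro _ ⟨j, hj, b, rfl⟩
  change prepend A (a ⊗ₜ word A j b) ∈ shortWords A (n + 1)
  rw [prepend_word]
  exact word_mem_shortWords (by omega) _

/-- The leading term of the value on a word is the word itself. -/
theorem coext_sub_mem_shortWords {A : DeltaAlg.{u, v} k} {F : Tc A →ₗ[k] A}
    (hF : ∀ a, F (single A a) = a) (n : ℕ) (a : Fin (n + 1) → A) :
    coext F (word A n a) - word A n a ∈ shortWords A n := by
  induction n using Nat.strong_induction_on with
  | _ n ih =>
  cases n with
  | zero =>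
    rw [word_zero, coext_apply, deconc_single, hF]
    simp
  | succ n =>
    have h : coext F (word A (n + 1) a) - word A (n + 1) a =
        single A (F (word A (n + 1) a)) +
        prepend A (a 0 ⊗ₜ (coext F (word A n (Fin.tail a)) - word A n (Fin.tail a))) +
        prepend A (TensorProduct.map F (coext F)
          (prependLeft A (a 0 ⊗ₜ deconc A (word A n (Fin.tail a))))) := by
      rw [coext_apply, word_succ, deconc_prepend_tmul, map_add, map_add, TensorProduct.map_tmul,
        hF, TensorProduct.tmul_sub, map_sub]
      abel
    rw [h]
    refine add_mem (add_mem ?_ ?_) ?_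
    · rw [single_apply]
      exact word_mem_shortWords (Nat.succ_pos n) _
    · exact prepend_mem_shortWords _ (ih n n.lt_succ_self _)
    · rw [deconc_word]
      simp only [TensorProduct.tmul_sum, map_sum, prependLeft_tmul, TensorProduct.map_tmul]
      refine sum_mem fun i _ => prepend_mem_shortWords _ ?_
      have h₁ := ih (n - 1 - i) (by omega) (fun j => Fin.tail a ⟨i + 1 + j, by omega⟩)
      have h₂ := add_mem (shortWords_mono A (by omega : n - 1 - i ≤ n) h₁)
        (word_mem_shortWords (by omega : n - 1 - i < n)
          (fun j => Fin.tail a ⟨i + 1 + j, by omega⟩))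
      rwa [sub_add_cancel] at h₂

theorem VanishesBelow.apply_mem {A : DeltaAlg.{u, v} k} {X : Type*} [AddCommGroup X] [Module k X]
    {f : Tc A →ₗ[k] X} {n : ℕ} (h : VanishesBelow f n) {t : Tc A} (ht : t ∈ shortWords A n) :
    f t = 0 := by
  have : shortWords A n ≤ LinearMap.ker f := by
    refine Submodule.span_le.2 ?_
    rintro _ ⟨j, hj, b, rfl⟩
    exact h j hj b
  exact this ht

/-- A morphism of the tensor coalgebra which is the identity on letters is invertible, as it is
unitriangular with respect to the length of words. -/
theorem exists_equiv_coext {A : DeltaAlg.{u, v} k} {F : Tc A →ₗ[k] A}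
    (hF : ∀ a, F (single A a) = a) : ∃ φ : Tc A ≃ₗ[k] Tc A, φ.toLinearMap = coext F := by
  -- a left inverse `ψ` is a fixed point of `ψ ↦ id + ψ ∘ (id - coext F)`
  let L : (Tc A →ₗ[k] Tc A) →ₗ[k] (Tc A →ₗ[k] Tc A) :=
    LinearMap.lcomp k (Tc A) (LinearMap.id - coext F)
  have hL' : ∀ f, L f = f - f ∘ₗ coext F := fun f => by
    refine LinearMap.ext fun t => ?_
    simp [L]
  have hL : ∀ f n, VanishesBelow f n → VanishesBelow (L f) (n + 1) := by
    intro f n h j hj a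
    have h₁ := h.apply_mem (shortWords_mono A (by omega : j ≤ n)
      (coext_sub_mem_shortWords hF j a))
    rw [map_sub] at h₁
    rw [hL', LinearMap.sub_apply, LinearMap.comp_apply, ← neg_sub, h₁, neg_zero]
  obtain ⟨ψ, hψ⟩ := exists_fixed hL LinearMap.id
  have h₁ : ψ ∘ₗ coext F = LinearMap.id := by
    rw [hL'] at hψ
    have : ψ ∘ₗ coext F = (LinearMap.id + (ψ - ψ ∘ₗ coext F)) - ψ + ψ ∘ₗ coext F := by
      rw [← hψ]; abel
    rw [this]
    abel
  have h₂ : coext F ∘ₗ ψ = LinearMap.id := by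
    refine sub_eq_zero.1 (eq_zero_of_fixed hL ?_)
    refine LinearMap.ext fun t => ?_
    have : ψ (coext F t) = t := LinearMap.congr_fun h₁ t
    simp [hL', this]
  exact ⟨LinearEquiv.ofLinearMap _ _ h₂ h₁, rfl⟩

/-! ### Components of morphisms and coderivations -/

/-- The linear map from the tensor coalgebra to `A` with given components. -/
def ofMult {A : DeltaAlg.{u, v} k} (m : ∀ n, Mult A n) : Tc A →ₗ[k] A :=
  DirectSum.toModule k ℕ _ fun n => PiTensorProduct.lift (m n)

theorem ofMult_word {A : DeltaAlg.{u, v} k} (m : ∀ n, Mult A n) (n : ℕ) (a : Fin (n + 1) → A) :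
    ofMult m (word A n a) = m n a := by
  rw [ofMult, word, LinearMap.compMultilinearMap_apply, DirectSum.toModule_lof,
    PiTensorProduct.lift.tprod]

theorem component_apply {A : DeltaAlg.{u, v} k} (θ : Tc A →ₗ[k] Tc A) (n : ℕ)
    (a : Fin (n + 1) → A) : component θ n a = proj A (θ (word A n a)) := rfl

theorem ofMult_component {A : DeltaAlg.{u, v} k} (θ : Tc A →ₗ[k] Tc A) :
    ofMult (component θ) = proj A ∘ₗ θ :=
  Tc.hom_ext fun n a => ofMult_word _ n a

theorem insertArgs_zero (A : DeltaAlg.{u, v} k) {n p l : ℕ} (h : p + 1 + l = n + 1) (q : ℕ)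
    (g : Mult A l) (a : Fin (n + 2) → A) :
    insertArgs A h q g 0 a =
      Fin.cons (g fun y => a ⟨y, by omega⟩) (fun x : Fin (p + 1) => a ⟨l + 1 + x, by omega⟩) := by
  funext x
  refine Fin.cases ?_ (fun x => ?_) x
  · simp [insertArgs]
  · rw [Fin.cons_succ, insertArgs, if_neg (Fin.not_lt_zero _), if_neg (Fin.succ_ne_zero x)]
    congr 2
    simp
    omega

theorem insertArgs_succ (A : DeltaAlg.{u, v} k) {n p l : ℕ} (h : p + 1 + l = n + 1)
    (h' : p + l = n) (q : ℕ) (g : Mult A l) (i : Fin (p + 1)) (a : Fin (n + 2) → A) :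
    insertArgs A h q g i.succ a =
      Fin.cons ((parity A ^ q) (a 0)) (insertArgs A h' q g i (Fin.tail a)) := by
  funext x
  refine Fin.cases ?_ (fun x => ?_) x
  · rw [Fin.cons_zero, insertArgs, if_pos (Fin.succ_pos i)]
    rfl
  · rw [Fin.cons_succ, insertArgs, insertArgs]
    simp only [Fin.succ_lt_succ_iff, Fin.succ_inj, Fin.tail]
    split_ifs
    · rfl
    · congr 1
      funext y
      congr 2
      simp
      omega
    · congr 2
      simp
      omega

theorem insertArgs_unary (A : DeltaAlg.{u, v} k) {l n : ℕ} (h : 0 + l = n) (q : ℕ)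
    (g : Mult A l) (i : Fin 1) (a : Fin (n + 1) → A) (x : Fin 1) :
    insertArgs A h q g i a x = g (fun y => a ⟨y, by omega⟩) := by
  rw [insertArgs, Subsingleton.elim x i, if_neg (lt_irrefl _), if_pos rfl]
  simp

/-- A sum over the antidiagonal, indexed by the first entry. The summands may depend on the proof of
membership, as those in the axioms of an `A∞`-algebra do. -/
theorem sum_antidiagonal_fst {X : Type*} [AddCommMonoid X] (n : ℕ) (f : ∀ p l, p + l = n → X) :
    ∑ r : Finset.HasAntidiagonal.antidiagonal n,
      f r.1.1 r.1.2 (Finset.HasAntidiagonal.mem_antidiagonal.1 r.2) =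
    ∑ p : Fin (n + 1), f p (n - p) (by omega) := by
  symm
  refine Finset.sum_bij' (fun p _ => ⟨(p, n - p), by simp; omega⟩)
    (fun r _ => ⟨r.1.1, by have := Finset.HasAntidiagonal.mem_antidiagonal.1 r.2; omega⟩)
    (fun _ _ => Finset.mem_univ _) (fun _ _ => Finset.mem_univ _) (fun _ _ => rfl) ?_
    (fun _ _ => rfl)
  rintro ⟨⟨p, l⟩, hr⟩ _
  have := Finset.HasAntidiagonal.mem_antidiagonal.1 hr
  simp only [Subtype.mk.injEq, Prod.mk.injEq, true_and]
  simp at this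
  omega

theorem sum_antidiagonal_snd {X : Type*} [AddCommMonoid X] (n : ℕ) (f : ∀ p l, p + l = n → X) :
    ∑ r : Finset.HasAntidiagonal.antidiagonal n,
      f r.1.1 r.1.2 (Finset.HasAntidiagonal.mem_antidiagonal.1 r.2) =
    ∑ l : Fin (n + 1), f (n - l) l (by omega) := by
  symm
  refine Finset.sum_bij' (fun l _ => ⟨(n - l, l), by simp; omega⟩)
    (fun r _ => ⟨r.1.2, by have := Finset.HasAntidiagonal.mem_antidiagonal.1 r.2; omega⟩)
    (fun _ _ => Finset.mem_univ _) (fun _ _ => Finset.mem_univ _) (fun _ _ => rfl) ?_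
    (fun _ _ => rfl)
  rintro ⟨⟨p, l⟩, hr⟩ _
  have := Finset.HasAntidiagonal.mem_antidiagonal.1 hr
  simp only [Subtype.mk.injEq, Prod.mk.injEq, and_true]
  simp at this
  omega

theorem sum_antidiagonal_succ {X : Type*} [AddCommMonoid X] (n : ℕ)
    (f : ∀ p l, p + l = n + 1 → X) :
    ∑ r : Finset.HasAntidiagonal.antidiagonal (n + 1),
      f r.1.1 r.1.2 (Finset.HasAntidiagonal.mem_antidiagonal.1 r.2) =
    f 0 (n + 1) (by omega) + ∑ r : Finset.HasAntidiagonal.antidiagonal n,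
      f (r.1.1 + 1) r.1.2
        (by have := Finset.HasAntidiagonal.mem_antidiagonal.1 r.2; omega) := by
  rw [sum_antidiagonal_fst, Fin.sum_univ_succ,
    sum_antidiagonal_fst n (fun p l h => f (p + 1) l (by omega))]
  have congr_l : ∀ (p l l' : ℕ) (h : p + l = n + 1) (h' : p + l' = n + 1), f p l h = f p l' h' := by
    intro p l l' h h'
    obtain rfl : l = l' := by omega
    rfl
  refine congrArg₂ _ rfl (Finset.sum_congr rfl fun p _ => ?_)
  exact congr_l (p + 1) _ _ _ _

/-- The explicit formula for the coderivation with components `m₁, m₂, …`. -/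
theorem coder_word {A : DeltaAlg.{u, v} k} (m : ∀ n, Mult A n) (n : ℕ) (a : Fin (n + 1) → A) :
    coder (ofMult m) (word A n a) =
      ∑ r : Finset.HasAntidiagonal.antidiagonal n, ∑ i : Fin (r.1.1 + 1),
        word A r.1.1 (insertArgs A (Finset.HasAntidiagonal.mem_antidiagonal.1 r.2) 1
          (m r.1.2) i a) := by
  induction n with
  | zero =>
    rw [sum_antidiagonal_fst 0 (fun p l h => ∑ i : Fin (p + 1),
      word A p (insertArgs A h 1 (m l) i a)), Fin.sum_univ_one]
    change _ = ∑ i : Fin 1, word A 0 (insertArgs A (l := 0) rfl 1 (m 0) i a)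
    rw [Fin.sum_univ_one, word_zero, word_zero, coder_apply, deconc_single, map_zero, map_zero,
      map_zero, add_zero, map_zero, add_zero, insertArgs_unary, ← word_zero, ofMult_word]
  | succ n ih =>
    have h₁ : prepend A (TensorProduct.map (parity A ∘ₗ proj A) (coder (ofMult m))
        (deconc A (word A (n + 1) a))) =
        prepend A (parity A (a 0) ⊗ₜ coder (ofMult m) (word A n (Fin.tail a))) := by
      rw [word_succ, deconc_prepend_tmul, map_add, map_prependLeft_eq_zero, add_zero,
        TensorProduct.map_tmul, LinearMap.comp_apply, proj_single]
    have h₂ : prepend A (TensorProduct.map (ofMult m) LinearMap.id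
        (deconc A (word A (n + 1) a))) =
        ∑ r : Finset.HasAntidiagonal.antidiagonal n,
          word A (r.1.1 + 1) (insertArgs A
            (by have := Finset.HasAntidiagonal.mem_antidiagonal.1 r.2; omega) 1
            (m r.1.2) 0 a) := by
      rw [sum_antidiagonal_snd n (fun p l h => word A (p + 1) (insertArgs A
        (by omega : p + 1 + l = n + 1) 1 (m l) 0 a)), deconc_word, map_sum, map_sum]
      refine Finset.sum_congr rfl fun i _ => ?_
      rw [TensorProduct.map_tmul, ofMult_word, insertArgs_zero, LinearMap.id_apply, ← prepend_word]
      rfl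
    rw [coder_apply, h₁, h₂, ih, sum_antidiagonal_succ n (fun p l h => ∑ i : Fin (p + 1),
      word A p (insertArgs A h 1 (m l) i a)), Fin.sum_univ_one, word_zero, insertArgs_unary,
      ofMult_word, add_assoc]
    refine congrArg₂ _ rfl ?_
    simp only [Fin.sum_univ_succ (n := _ + 1)]
    rw [Finset.sum_add_distrib]
    refine congrArg₂ _ rfl ?_
    simp only [TensorProduct.tmul_sum, map_sum, prepend_word]
    refine Finset.sum_congr rfl fun r _ => Finset.sum_congr rfl fun i _ => ?_
    rw [insertArgs_succ A _ (Finset.HasAntidiagonal.mem_antidiagonal.1 r.2), pow_one]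

/-- The coderivation of the trivial `A∞`-algebra is the one whose projection to `A` is `Δ`. -/
theorem trivialCoder_eq (A : DeltaAlg.{u, v} k) : trivialCoder A = coder (A.Δ ∘ₗ proj A) := by
  have hw : ∀ n a, trivialCoder A (word A n a) = ∑ i : Fin (n + 1),
      word A n fun j =>
        (if j < i then parity A else if j = i then A.Δ else LinearMap.id) (a j) := by
    intro n a
    rw [trivialCoder, word, LinearMap.compMultilinearMap_apply, DirectSum.toModule_lof,
      LinearMap.comp_apply, LinearMap.sum_apply, map_sum]
    refine Finset.sum_congr rfl fun i _ => ?_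
    rw [PiTensorProduct.map_tprod]
    rfl
  refine Tc.hom_ext fun n => ?_
  induction n with
  | zero =>
    intro a
    rw [hw, Fin.sum_univ_one, word_zero, word_zero, coder_apply, deconc_single]
    simp [proj_single]
  | succ n ih =>
    intro a
    rw [hw, Fin.sum_univ_succ, word_succ A n a, coder_apply, deconc_prepend_tmul, map_add, map_add,
      map_prependLeft_eq_zero, map_add, map_prependLeft_eq_zero, TensorProduct.map_tmul,
      TensorProduct.map_tmul, LinearMap.comp_apply, LinearMap.comp_apply, LinearMap.comp_apply,
      proj_single, proj_prepend, map_zero, map_zero, ← ih, hw, zero_add, add_zero, map_zero,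
      add_zero, LinearMap.id_apply, TensorProduct.tmul_sum, map_sum]
    refine congrArg₂ _ ?_ (Finset.sum_congr rfl fun i _ => ?_)
    · rw [word_succ]
      refine congrArg _ (congrArg₂ _ ?_ (congrArg _ (funext fun j => ?_)))
      · simp
      · simp [Fin.tail, Fin.succ_ne_zero]
    · rw [word_succ]
      refine congrArg _ (congrArg₂ _ ?_ (congrArg _ (funext fun j => ?_)))
      · simp
      · simp [Fin.tail]

/-! ### Twisting -/

/-- A twisting of the trivial `A∞`-algebra by `φ` has the components `m₁, m₂, …` if and only if `φ`
intertwines the coderivation with these components with `Δ`. -/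
theorem twist_iff {A : DeltaAlg.{u, v} k} (φ : Tc A ≃ₗ[k] Tc A)
    (hφ : deconc A ∘ₗ φ.toLinearMap =
      TensorProduct.map φ.toLinearMap φ.toLinearMap ∘ₗ deconc A)
    (hpar : ∀ n a, component φ.toLinearMap n (fun i => parity A (a i)) =
      parity A (component φ.toLinearMap n a)) (m : ∀ n, Mult A n) :
    (∀ n, m n = component (twist φ (trivialCoder A)) n) ↔
      ∀ n a, ofMult (component φ.toLinearMap) (coder (ofMult m) (word A n a)) =
        A.Δ (component φ.toLinearMap n a) := by
  have hd : ∀ t, deconc A (φ t) = TensorProduct.map φ.toLinearMap φ.toLinearMap (deconc A t) :=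
    LinearMap.congr_fun hφ
  have hd' : ∀ t, deconc A (φ.symm t) =
      TensorProduct.map φ.symm.toLinearMap φ.symm.toLinearMap (deconc A t) := fun t => by
    obtain ⟨t, rfl⟩ := φ.surjective t
    rw [hd, TensorProduct.map_map]
    simp
  have hP : φ.toLinearMap ∘ₗ parityTc A = parityTc A ∘ₗ φ.toLinearMap := by
    have h₁ : deconc A ∘ₗ (φ.toLinearMap ∘ₗ parityTc A) = TensorProduct.map
        (φ.toLinearMap ∘ₗ parityTc A) (φ.toLinearMap ∘ₗ parityTc A) ∘ₗ deconc A := by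
      refine LinearMap.ext fun t => ?_
      simp only [LinearMap.comp_apply, LinearEquiv.coe_coe, hd, deconc_parityTc,
        TensorProduct.map_map]
    have h₂ : deconc A ∘ₗ (parityTc A ∘ₗ φ.toLinearMap) = TensorProduct.map
        (parityTc A ∘ₗ φ.toLinearMap) (parityTc A ∘ₗ φ.toLinearMap) ∘ₗ deconc A := by
      refine LinearMap.ext fun t => ?_
      simp only [LinearMap.comp_apply, LinearEquiv.coe_coe, hd, deconc_parityTc,
        TensorProduct.map_map]
    rw [coalgHom_eq_coext h₁, coalgHom_eq_coext h₂]
    congr 1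
    refine Tc.hom_ext fun n a => ?_
    have := hpar n a
    simp only [component_apply, LinearEquiv.coe_coe] at this
    simp only [LinearMap.comp_apply, LinearEquiv.coe_coe, parityTc_word]
    rw [this]
    simp [parityTc, proj_coext]
  have hP' : φ.symm.toLinearMap ∘ₗ parityTc A ∘ₗ φ.toLinearMap = parityTc A := by
    rw [← hP, ← LinearMap.comp_assoc]
    simp
  have hT : IsOddCoder (twist φ (trivialCoder A)) := by
    have h := isOddCoder_coder (A.Δ ∘ₗ proj A)
    rw [← trivialCoder_eq] at h
    refine LinearMap.ext fun t => ?_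
    simp only [twist, LinearMap.comp_apply, LinearEquiv.coe_coe, hd, hd', h.apply, map_add,
      TensorProduct.map_map, LinearMap.add_apply, LinearMap.id_comp, hP']
    simp
  have hproj : ∀ t, proj A (trivialCoder A t) = A.Δ (proj A t) := fun t => by
    rw [trivialCoder_eq, proj_coder, LinearMap.comp_apply]
  rw [ofMult_component]
  constructor
  · intro h n a
    have hm : coder (ofMult m) = twist φ (trivialCoder A) := by
      refine (isOddCoder_coder _).ext hT (Tc.hom_ext fun n a => ?_)
      rw [LinearMap.comp_apply, proj_coder, ofMult_word, h]
      rfl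
    rw [hm]
    simp [twist, hproj, component_apply]
  · intro h n
    have key : φ.toLinearMap ∘ₗ coder (ofMult m) = trivialCoder A ∘ₗ φ.toLinearMap := by
      have h₁ := isOddCoder_coder (ofMult m)
      have h₂ := isOddCoder_coder (A.Δ ∘ₗ proj A)
      rw [← trivialCoder_eq] at h₂
      refine eq_of_proj_comp_eq (p := φ.toLinearMap) (q := φ.toLinearMap ∘ₗ parityTc A) ?_ ?_ ?_
      · refine LinearMap.ext fun t => ?_
        simp only [LinearMap.comp_apply, LinearEquiv.coe_coe, hd, h₁.apply, map_add,
          TensorProduct.map_map, LinearMap.add_apply, LinearMap.comp_id]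
      · refine LinearMap.ext fun t => ?_
        simp only [LinearMap.comp_apply, LinearEquiv.coe_coe, hd, h₂.apply,
          TensorProduct.map_map, LinearMap.add_apply, LinearMap.id_comp, hP]
      · refine Tc.hom_ext fun n a => ?_
        have := h n a
        simp only [component_apply, LinearMap.comp_apply, LinearEquiv.coe_coe] at this
        simp [hproj, this]
    ext a
    rw [component_apply, twist, ← key, ← ofMult_word m, ← proj_coder]
    simp

/-! ### Degrees and parity -/

/-- Multilinear operations are determined by their values on homogeneous elements. -/
theorem Mult.ext_homogeneous {A : DeltaAlg.{u, v} k} {X : Type*} [AddCommGroup X] [Module k X]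
    {n : ℕ} {f g : MultilinearMap k (fun _ : Fin (n + 1) => (A : Type v)) X}
    (h : ∀ (d : Fin (n + 1) → ℤ) (a : Fin (n + 1) → A), (∀ i, a i ∈ A.deg (d i)) → f a = g a) :
    f = g := by
  suffices key : ∀ (s : Finset (Fin (n + 1))) (a : Fin (n + 1) → A),
      (∀ i ∉ s, ∃ d, a i ∈ A.deg d) → f a = g a from
    MultilinearMap.ext fun a => key Finset.univ a fun i hi => absurd (Finset.mem_univ i) hi
  intro s
  induction s using Finset.induction_on with
  | empty =>
    intro a ha
    choose d hd using fun i => ha i (Finset.notMem_empty i)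
    exact h d a hd
  | insert j s hj ih =>
    intro a ha
    suffices ∀ x : A, f (Function.update a j x) = g (Function.update a j x) by
      simpa using this (a j)
    intro x
    induction x using DirectSum.Decomposition.inductionOn A.deg with
    | zero => rw [f.map_update_zero, g.map_update_zero]
    | add x y hx hy => rw [f.map_update_add, g.map_update_add, hx, hy]
    | @homogeneous d x =>
      refine ih _ fun i hi => ?_
      by_cases hij : i = j
      · subst hij
        exact ⟨d, by simp⟩
      · rw [Function.update_of_ne hij]
        exact ha i (by simp [hij, hi])

theorem parity_mem {A : DeltaAlg.{u, v} k} {i : ℤ} {a : A} (ha : a ∈ A.deg i) :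
    parity A a ∈ A.deg i := by
  rw [parity_of_mem A ha]
  exact zsmul_mem ha _

theorem parity_mul (A : DeltaAlg.{u, v} k) (a b : A) :
    parity A (a * b) = parity A a * parity A b := by
  induction a using DirectSum.Decomposition.inductionOn A.deg with
  | zero => simp
  | add x y hx hy => simp only [add_mul, map_add, hx, hy]
  | @homogeneous i x =>
    induction b using DirectSum.Decomposition.inductionOn A.deg with
    | zero => simp
    | add x y hx hy => simp only [mul_add, map_add, hx, hy]
    | @homogeneous j y =>
      rw [parity_of_mem A (A.mul_mem x.2 y.2), parity_of_mem A x.2, parity_of_mem A y.2,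
        Int.negOnePow_add, Units.val_mul, smul_mul_smul_comm]

theorem parity_Δ (A : DeltaAlg.{u, v} k) (a : A) : parity A (A.Δ a) = -A.Δ (parity A a) := by
  induction a using DirectSum.Decomposition.inductionOn A.deg with
  | zero => simp
  | add x y hx hy => simp only [map_add, hx, hy, neg_add]
  | @homogeneous i x =>
    rw [parity_of_mem A (A.Δ_mem x.2), parity_of_mem A x.2, Int.negOnePow_succ, map_zsmul]
    simp

/-- Natural operations of degree `q` commute with the parity up to the sign `(-1)^q`. -/
theorem IsNatural.parity_apply {n q : ℕ} {β : OpFamily.{u, v} k n} (hβ : IsNatural n q β) :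
    ∀ (A : DeltaAlg.{u, v} k) (a : Fin (n + 1) → A),
      β A (fun i => parity A (a i)) = (-1 : k) ^ q • parity A (β A a) := by
  induction hβ with
  | ident β hβ => intro A a; simp [hβ]
  | differential β hβ => intro A a; simp [hβ, parity_Δ]
  | product β hβ => intro A a; simp [hβ, parity_mul]
  | @comp n p l q r h i f g β _ _ hβ ihf ihg =>
    intro A a
    have key : insertArgs A h q (g A) i (fun i => parity A (a i)) =
        Function.update (fun x => parity A (insertArgs A h q (g A) i a x)) i
          ((-1 : k) ^ q • parity A (insertArgs A h q (g A) i a i)) := by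
      funext x
      have hcomm : ∀ y : A, (parity A ^ q) (parity A y) = parity A ((parity A ^ q) y) := fun y => by
        rw [← Module.End.mul_apply, ← Module.End.mul_apply, ← pow_succ, ← pow_succ']
      rcases lt_trichotomy x i with hx | rfl | hx
      · rw [Function.update_of_ne hx.ne]
        simp only [insertArgs, if_pos hx, hcomm]
      · simp [insertArgs, ihg]
      · rw [Function.update_of_ne hx.ne']
        simp only [insertArgs, if_neg hx.not_gt, if_neg hx.ne']
    rw [hβ, key, MultilinearMap.map_update_smul, Function.update_eq_self i
      (fun x => parity A (insertArgs A h q (g A) i a x)), ihf, hβ, smul_smul, ← pow_add,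
      add_comm q r]
  | @perm n q σ f β _ hβ ihf =>
    intro A
    suffices (β A).compLinearMap (fun _ => parity A) =
        (-1 : k) ^ q • (parity A).compMultilinearMap (β A) from
      fun a => DFunLike.congr_fun this a
    refine Mult.ext_homogeneous fun d a ha => ?_
    simp only [MultilinearMap.compLinearMap_apply, smul_apply,
      LinearMap.compMultilinearMap_apply]
    rw [hβ A d _ (fun i => parity_mem (ha i)), hβ A d a ha, map_zsmul,
      ihf A (fun i => a (σ i)), smul_comm]
  | zero n q => intro A a; simp
  | add f g _ _ ihf ihg => intro A a; simp [ihf, ihg]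
  | @smul n q c f _ ih =>
    intro A a
    simp only [Pi.smul_apply, smul_apply, map_smul, ih, smul_comm c]

/-! ### The extension which separates products from their differentials -/

/-- The underlying space of the extension `A ⊕ A ⊕ A[-1]` of `A`. -/
structure Ext (A : DeltaAlg.{u, v} k) : Type v where
  /-- the underlying element of `A` -/
  fst : A
  /-- the part which is a linear combination of products -/
  snd : A
  /-- the part to which `Δ` is applied -/
  thd : A

namespace Ext

variable {A : DeltaAlg.{u, v} k}

/-- The bijection of the extension with the triples of elements. -/
def equiv : Ext A ≃ A.carrier × A.carrier × A.carrier where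
  toFun x := (x.fst, x.snd, x.thd)
  invFun x := ⟨x.1, x.2.1, x.2.2⟩

instance : AddCommGroup (Ext A) := equiv.addCommGroup

instance : Module k (Ext A) := equiv.module k

theorem ext {x y : Ext A} (h₁ : x.fst = y.fst) (h₂ : x.snd = y.snd) (h₃ : x.thd = y.thd) :
    x = y := by
  cases x; cases y; simp_all

@[simp] theorem fst_add (x y : Ext A) : (x + y).fst = x.fst + y.fst := rfl
@[simp] theorem snd_add (x y : Ext A) : (x + y).snd = x.snd + y.snd := rfl
@[simp] theorem thd_add (x y : Ext A) : (x + y).thd = x.thd + y.thd := rfl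
@[simp] theorem fst_zero : (0 : Ext A).fst = 0 := rfl
@[simp] theorem snd_zero : (0 : Ext A).snd = 0 := rfl
@[simp] theorem thd_zero : (0 : Ext A).thd = 0 := rfl
@[simp] theorem fst_smul (c : k) (x : Ext A) : (c • x).fst = c • x.fst := rfl
@[simp] theorem snd_smul (c : k) (x : Ext A) : (c • x).snd = c • x.snd := rfl
@[simp] theorem thd_smul (c : k) (x : Ext A) : (c • x).thd = c • x.thd := rfl

/-- The first coordinate, as a linear map. -/
def fstₗ : Ext A →ₗ[k] A where
  toFun := fst
  map_add' _ _ := rfl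
  map_smul' _ _ := rfl

/-- The second coordinate, as a linear map. -/
def sndₗ : Ext A →ₗ[k] A where
  toFun := snd
  map_add' _ _ := rfl
  map_smul' _ _ := rfl

/-- The third coordinate, as a linear map. -/
def thdₗ : Ext A →ₗ[k] A where
  toFun := thd
  map_add' _ _ := rfl
  map_smul' _ _ := rfl

/-- The elements whose second and third coordinate vanish. -/
def inlₗ : A →ₗ[k] Ext A where
  toFun a := ⟨a, 0, 0⟩
  map_add' _ _ := Ext.ext rfl (add_zero _).symm (add_zero _).symm
  map_smul' c _ := Ext.ext rfl (smul_zero c).symm (smul_zero c).symm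

instance : Mul (Ext A) := ⟨fun x y => ⟨x.fst * y.fst, x.fst * y.fst, 0⟩⟩

@[simp] theorem fst_mul (x y : Ext A) : (x * y).fst = x.fst * y.fst := rfl
@[simp] theorem snd_mul (x y : Ext A) : (x * y).snd = x.fst * y.fst := rfl
@[simp] theorem thd_mul (x y : Ext A) : (x * y).thd = 0 := rfl

instance : NonUnitalRing (Ext A) where
  left_distrib _ _ _ := Ext.ext (by simp [mul_add]) (by simp [mul_add]) (by simp)
  right_distrib _ _ _ := Ext.ext (by simp [add_mul]) (by simp [add_mul]) (by simp)
  zero_mul _ := Ext.ext (by simp) (by simp) (by simp)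
  mul_zero _ := Ext.ext (by simp) (by simp) (by simp)
  mul_assoc _ _ _ := Ext.ext (by simp [mul_assoc]) (by simp [mul_assoc]) (by simp)

instance : IsScalarTower k (Ext A) (Ext A) :=
  ⟨fun c _ _ => Ext.ext (smul_mul_assoc c _ _) (smul_mul_assoc c _ _) (smul_zero c).symm⟩

instance : SMulCommClass k (Ext A) (Ext A) :=
  ⟨fun c _ _ => Ext.ext (mul_smul_comm c _ _).symm (mul_smul_comm c _ _).symm (smul_zero c)⟩

/-- The homogeneous parts of the extension. -/
def deg (A : DeltaAlg.{u, v} k) (i : ℤ) : Submodule k (Ext A) :=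
  (A.deg i).comap fstₗ ⊓ ((A.deg i).comap sndₗ ⊓ (A.deg (i - 1)).comap thdₗ)

theorem mem_deg {i : ℤ} {x : Ext A} :
    x ∈ deg A i ↔ x.fst ∈ A.deg i ∧ x.snd ∈ A.deg i ∧ x.thd ∈ A.deg (i - 1) := Iff.rfl

theorem isInternal_deg (A : DeltaAlg.{u, v} k) : DirectSum.IsInternal (deg A) := by
  have hA := (DirectSum.Decomposition.isInternal A.deg).submodule_iSupIndep
  have key : ∀ (f : Ext A →ₗ[k] A) (B : ℤ → Submodule k A), iSupIndep B →
      (∀ i, deg A i ≤ (B i).comap f) →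
      ∀ i x, x ∈ deg A i → x ∈ ⨆ j, ⨆ (_ : j ≠ i), deg A j → f x = 0 := by
    intro f B hB hf i x hx hx'
    refine Submodule.disjoint_def.1 (hB i) _ (hf i hx) ?_
    have : (⨆ j, ⨆ (_ : j ≠ i), deg A j) ≤ (⨆ j, ⨆ (_ : j ≠ i), B j).comap f :=
      iSup₂_le fun j hj => (hf j).trans (Submodule.comap_mono (le_iSup₂ (f := fun j _ => B j) j hj))
    exact this hx'
  refine DirectSum.isInternal_submodule_of_iSupIndep_of_iSup_eq_top (fun i => ?_) ?_
  · refine Submodule.disjoint_def.2 fun x hx hx' => Ext.ext ?_ ?_ ?_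
    · exact key fstₗ _ hA (fun i x hx => hx.1) i x hx hx'
    · exact key sndₗ _ hA (fun i x hx => hx.2.1) i x hx hx'
    · exact key thdₗ _ (hA.comp (sub_left_injective (b := (1 : ℤ)))) (fun i x hx => hx.2.2)
        i x hx hx'
  · refine eq_top_iff.2 fun x _ => ?_
    have mem : ∀ {i : ℤ} {y : Ext A}, y ∈ deg A i → y ∈ iSup (deg A) :=
      fun {i} _ hy => Submodule.mem_iSup_of_mem i hy
    have h₁ : ∀ a : A, (⟨a, 0, 0⟩ : Ext A) ∈ iSup (deg A) := fun a => by
      induction a using DirectSum.Decomposition.inductionOn A.deg with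
      | zero => exact zero_mem _
      | add a b ha hb => convert add_mem ha hb using 1; exact Ext.ext rfl (by simp) (by simp)
      | homogeneous a => exact mem (mem_deg.2 ⟨a.2, zero_mem _, zero_mem _⟩)
    have h₂ : ∀ a : A, (⟨0, a, 0⟩ : Ext A) ∈ iSup (deg A) := fun a => by
      induction a using DirectSum.Decomposition.inductionOn A.deg with
      | zero => exact zero_mem _
      | add a b ha hb => convert add_mem ha hb using 1; exact Ext.ext (by simp) rfl (by simp)
      | homogeneous a => exact mem (mem_deg.2 ⟨zero_mem _, a.2, zero_mem _⟩)
    have h₃ : ∀ a : A, (⟨0, 0, a⟩ : Ext A) ∈ iSup (deg A) := fun a => by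
      induction a using DirectSum.Decomposition.inductionOn A.deg with
      | zero => exact zero_mem _
      | add a b ha hb => convert add_mem ha hb using 1; exact Ext.ext (by simp) (by simp) rfl
      | @homogeneous i a =>
        exact mem (i := i + 1) (mem_deg.2 ⟨zero_mem _, zero_mem _, by simp⟩)
    convert add_mem (add_mem (h₁ x.fst) (h₂ x.snd)) (h₃ x.thd) using 1
    exact Ext.ext (by simp) (by simp) (by simp)

instance : DirectSum.Decomposition (deg A) := (isInternal_deg A).chooseDecomposition

end Ext

/-- The extension of `A` in which a product `x y` is recorded in the second coordinate, and the
differential moves the second coordinate to the third one. Only the first coordinates of `x` and `y`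
contribute to `x y`, so that the coordinates of a value of an operation tell which part of it is
the value of a product and which one is `Δ` of a product. -/
def extAlg (A : DeltaAlg.{u, v} k) : DeltaAlg.{u, v} k where
  carrier := Ext A
  deg := Ext.deg A
  mul_mem {i j x y} hx hy := by
    rw [Ext.mem_deg] at *
    exact ⟨A.mul_mem hx.1 hy.1, A.mul_mem hx.1 hy.1, zero_mem _⟩
  Δ :=
    { toFun := fun x => ⟨A.Δ x.fst, 0, x.snd⟩
      map_add' := fun x y => Ext.ext (by simp) (by simp) rfl
      map_smul' := fun x y => Ext.ext (by simp) (by simp) rfl }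
  Δ_mem {i x} hx := by
    rw [Ext.mem_deg] at *
    refine ⟨A.Δ_mem hx.1, zero_mem _, ?_⟩
    simpa using hx.2.1
  Δ_sq x := Ext.ext (A.Δ_sq _) rfl rfl

/-- The first coordinate of the extension, a morphism of algebras with a differential. -/
def extFst (A : DeltaAlg.{u, v} k) : extAlg A →ₗ[k] A := Ext.fstₗ

/-- The second coordinate of the extension. -/
def extSnd (A : DeltaAlg.{u, v} k) : extAlg A →ₗ[k] A := Ext.sndₗ

/-- The third coordinate of the extension. -/
def extThd (A : DeltaAlg.{u, v} k) : extAlg A →ₗ[k] A := Ext.thdₗ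

/-- The inclusion of the first coordinate of the extension. -/
def extInl (A : DeltaAlg.{u, v} k) : A →ₗ[k] extAlg A := Ext.inlₗ

section

variable (A : DeltaAlg.{u, v} k)

theorem extAlg_ext {x y : extAlg A} (h₁ : extFst A x = extFst A y) (h₂ : extSnd A x = extSnd A y)
    (h₃ : extThd A x = extThd A y) : x = y := Ext.ext h₁ h₂ h₃

@[simp] theorem extFst_inl (a : A) : extFst A (extInl A a) = a := rfl
@[simp] theorem extFst_mul (x y : extAlg A) : extFst A (x * y) = extFst A x * extFst A y := rfl
@[simp] theorem extSnd_mul (x y : extAlg A) : extSnd A (x * y) = extFst A x * extFst A y := rfl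
@[simp] theorem extThd_mul (x y : extAlg A) : extThd A (x * y) = 0 := rfl
@[simp] theorem extFst_Δ (x : extAlg A) : extFst A ((extAlg A).Δ x) = A.Δ (extFst A x) := rfl
@[simp] theorem extSnd_Δ (x : extAlg A) : extSnd A ((extAlg A).Δ x) = 0 := rfl
@[simp] theorem extThd_Δ (x : extAlg A) : extThd A ((extAlg A).Δ x) = extSnd A x := rfl

theorem extFst_mem {i : ℤ} {x : extAlg A} (hx : x ∈ (extAlg A).deg i) : extFst A x ∈ A.deg i :=
  (Ext.mem_deg.1 hx).1

theorem extInl_mem {i : ℤ} {a : A} (ha : a ∈ A.deg i) : extInl A a ∈ (extAlg A).deg i :=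
  Ext.mem_deg.2 ⟨ha, zero_mem _, zero_mem _⟩

end

/-! ### Naturality -/

theorem parity_map {A B : DeltaAlg.{u, v} k} (f : A →ₗ[k] B)
    (hf : ∀ i a, a ∈ A.deg i → f a ∈ B.deg i) (a : A) : f (parity A a) = parity B (f a) := by
  induction a using DirectSum.Decomposition.inductionOn A.deg with
  | zero => simp
  | add x y hx hy => simp only [map_add, hx, hy]
  | @homogeneous i x =>
    rw [parity_of_mem A x.2, parity_of_mem B (hf i _ x.2), map_zsmul]

theorem parity_pow_map {A B : DeltaAlg.{u, v} k} (f : A →ₗ[k] B)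
    (hf : ∀ i a, a ∈ A.deg i → f a ∈ B.deg i) (q : ℕ) (a : A) :
    f ((parity A ^ q) a) = (parity B ^ q) (f a) := by
  induction q generalizing a with
  | zero => rfl
  | succ q ih => rw [pow_succ, pow_succ, Module.End.mul_apply, Module.End.mul_apply, ih,
      parity_map f hf]

theorem insertArgs_map {A B : DeltaAlg.{u, v} k} (f : A →ₗ[k] B)
    (hf : ∀ i a, a ∈ A.deg i → f a ∈ B.deg i) {n p l : ℕ} (h : p + l = n) (q : ℕ)
    (gA : Mult A l) (gB : Mult B l) (hg : ∀ a, f (gA a) = gB (fun j => f (a j)))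
    (i : Fin (p + 1)) (a : Fin (n + 1) → A) (x : Fin (p + 1)) :
    f (insertArgs A h q gA i a x) = insertArgs B h q gB i (fun j => f (a j)) x := by
  unfold insertArgs
  split_ifs
  · exact parity_pow_map f hf q _
  · exact hg _
  · rfl

/-- Natural operations commute with morphisms of graded algebras with a differential. -/
theorem IsNatural.map_apply {n q : ℕ} {β : OpFamily.{u, v} k n} (hβ : IsNatural n q β)
    {A B : DeltaAlg.{u, v} k} (f : A →ₗ[k] B) (hf : ∀ i a, a ∈ A.deg i → f a ∈ B.deg i)
    (hmul : ∀ a b, f (a * b) = f a * f b) (hΔ : ∀ a, f (A.Δ a) = B.Δ (f a)) :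
    ∀ a : Fin (n + 1) → A, f (β A a) = β B (fun i => f (a i)) := by
  induction hβ with
  | ident β hβ => intro a; simp [hβ]
  | differential β hβ => intro a; simp [hβ, hΔ]
  | product β hβ => intro a; simp [hβ, hmul]
  | @comp n p l q r h i g₁ g₂ β _ _ hβ ih₁ ih₂ =>
    intro a
    rw [hβ, hβ, ih₁]
    exact congrArg _ (funext fun x => insertArgs_map f hf h q _ _ ih₂ i a x)
  | @perm n q σ g β _ hβ ih =>
    suffices h : f.compMultilinearMap (β A) = (β B).compLinearMap (fun _ => f) from
      fun a => DFunLike.congr_fun h a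
    refine Mult.ext_homogeneous fun d a ha => ?_
    rw [LinearMap.compMultilinearMap_apply, MultilinearMap.compLinearMap_apply, hβ A d a ha,
      hβ B d _ (fun i => hf _ _ (ha i)), map_zsmul, ih]
  | zero n q => intro a; simp
  | add f g _ _ ihf ihg => intro a; simp [ihf, ihg]
  | smul c f _ ih => intro a; simp [ih]

theorem IsNatural.extFst_apply {n q : ℕ} {β : OpFamily.{u, v} k n} (hβ : IsNatural n q β)
    (A : DeltaAlg.{u, v} k) (x : Fin (n + 1) → extAlg A) :
    extFst A (β (extAlg A) x) = β A (fun i => extFst A (x i)) :=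
  hβ.map_apply (extFst A) (fun _ _ => extFst_mem A) (extFst_mul A) (extFst_Δ A) x

theorem insertArgs_extFst {A : DeltaAlg.{u, v} k} {n p l q : ℕ} {g : OpFamily.{u, v} k l}
    (hg : IsNatural l q g) (h : p + l = n) (i : Fin (p + 1)) (x : Fin (n + 1) → extAlg A)
    (y : Fin (p + 1)) :
    extFst A (insertArgs (extAlg A) h q (g (extAlg A)) i x y) =
      insertArgs A h q (g A) i (fun j => extFst A (x j)) y :=
  insertArgs_map (extFst A) (fun _ _ => extFst_mem A) h q _ _ (hg.extFst_apply A) i x y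

/-- The values of a natural operation with at least two inputs on the extension depend on the first
coordinates of the inputs only. -/
theorem IsNatural.apply_inl_fst {n q : ℕ} {β : OpFamily.{u, v} k n} (hβ : IsNatural n q β)
    (hn : n ≠ 0) (A : DeltaAlg.{u, v} k) : ∀ x : Fin (n + 1) → extAlg A,
    β (extAlg A) x = β (extAlg A) (fun i => extInl A (extFst A (x i))) := by
  induction hβ with
  | ident β hβ => exact absurd rfl hn
  | differential β hβ => exact absurd rfl hn
  | product β hβ => intro x; rw [hβ, hβ]; exact extAlg_ext A rfl rfl rfl
  | @comp n p l q r h i f g β hf hg hβ ihf ihg =>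
    intro x
    rw [hβ, hβ]
    -- an operation `f` with one input passes the values of `g` on, one with more inputs sees only
    -- the first coordinates of these values
    by_cases hp : p = 0
    · subst hp
      refine congrArg _ (funext fun y => ?_)
      rw [insertArgs_unary, insertArgs_unary, ihg (by omega)]
    · rw [ihf hp, ihf hp (insertArgs _ _ _ _ _ fun i => extInl A (extFst A (x i)))]
      refine congrArg _ (funext fun y => ?_)
      rw [insertArgs_extFst hg, insertArgs_extFst hg]
      rfl
  | @perm n q σ f β _ hβ ih =>
    suffices h : β (extAlg A) = (β (extAlg A)).compLinearMap
        (fun _ => (extInl A) ∘ₗ (extFst A)) from fun x => DFunLike.congr_fun h x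
    refine Mult.ext_homogeneous fun d x hx => ?_
    rw [hβ _ d x hx, ih hn]
    exact (hβ _ d _ (fun i => extInl_mem A (extFst_mem A (hx i)))).symm
  | zero n q => intro x; simp
  | add f g _ _ ihf ihg => intro x; simp [← ihf hn x, ← ihg hn x]
  | smul c f _ ih => intro x; simp [← ih hn x]

/-! ### The decomposition of natural operations -/

/-- The part of an operation which consists of products: the second coordinate of its values on the
extension. -/
def prodPart {n : ℕ} (β : OpFamily.{u, v} k n) : OpFamily.{u, v} k n := fun A =>
  (extSnd A).compMultilinearMap ((β (extAlg A)).compLinearMap fun _ => extInl A)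

/-- The part of an operation to which `Δ` is applied: the third coordinate of its values on the
extension. -/
def diffPart {n : ℕ} (β : OpFamily.{u, v} k n) : OpFamily.{u, v} k n := fun A =>
  (extThd A).compMultilinearMap ((β (extAlg A)).compLinearMap fun _ => extInl A)

theorem prodPart_apply {n : ℕ} (β : OpFamily.{u, v} k n) (A : DeltaAlg.{u, v} k)
    (a : Fin (n + 1) → A) :
    prodPart β A a = extSnd A (β (extAlg A) fun i => extInl A (a i)) := rfl

theorem diffPart_apply {n : ℕ} (β : OpFamily.{u, v} k n) (A : DeltaAlg.{u, v} k)
    (a : Fin (n + 1) → A) :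
    diffPart β A a = extThd A (β (extAlg A) fun i => extInl A (a i)) := rfl

theorem IsNatural.extSnd_apply {n q : ℕ} {β : OpFamily.{u, v} k n} (hβ : IsNatural n q β)
    (hn : n ≠ 0) (A : DeltaAlg.{u, v} k) (x : Fin (n + 1) → extAlg A) :
    extSnd A (β (extAlg A) x) = prodPart β A (fun i => extFst A (x i)) := by
  rw [hβ.apply_inl_fst hn]
  rfl

theorem IsNatural.extThd_apply {n q : ℕ} {β : OpFamily.{u, v} k n} (hβ : IsNatural n q β)
    (hn : n ≠ 0) (A : DeltaAlg.{u, v} k) (x : Fin (n + 1) → extAlg A) :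
    extThd A (β (extAlg A) x) = diffPart β A (fun i => extFst A (x i)) := by
  rw [hβ.apply_inl_fst hn]
  rfl

section Comp

variable {n p l q r : ℕ} {h : p + l = n} {i : Fin (p + 1)} {f : OpFamily.{u, v} k p}
  {g : OpFamily.{u, v} k l} {β : OpFamily.{u, v} k n}

theorem prodPart_comp (hf : IsNatural p r f) (hp : p ≠ 0) (hg : IsNatural l q g)
    (hβ : ∀ A a, β A a = f A (insertArgs A h q (g A) i a)) (A : DeltaAlg.{u, v} k)
    (a : Fin (n + 1) → A) :
    prodPart β A a = prodPart f A (insertArgs A h q (g A) i a) := by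
  rw [prodPart_apply, hβ, hf.extSnd_apply hp]
  exact congrArg _ (funext fun y => insertArgs_extFst hg h i _ y)

theorem diffPart_comp (hf : IsNatural p r f) (hp : p ≠ 0) (hg : IsNatural l q g)
    (hβ : ∀ A a, β A a = f A (insertArgs A h q (g A) i a)) (A : DeltaAlg.{u, v} k)
    (a : Fin (n + 1) → A) :
    diffPart β A a = diffPart f A (insertArgs A h q (g A) i a) := by
  rw [diffPart_apply, hβ, hf.extThd_apply hp]
  exact congrArg _ (funext fun y => insertArgs_extFst hg h i _ y)

end Comp

theorem prodPart_perm {n : ℕ} {σ : Equiv.Perm (Fin (n + 1))} {f β : OpFamily.{u, v} k n}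
    (hβ : ∀ (A : DeltaAlg.{u, v} k) (d : Fin (n + 1) → ℤ) (a : Fin (n + 1) → A),
      (∀ i, a i ∈ A.deg (d i)) → β A a = (koszulSign σ d : ℤ) • f A (fun i => a (σ i)))
    (A : DeltaAlg.{u, v} k) (d : Fin (n + 1) → ℤ) (a : Fin (n + 1) → A)
    (ha : ∀ i, a i ∈ A.deg (d i)) :
    prodPart β A a = (koszulSign σ d : ℤ) • prodPart f A (fun i => a (σ i)) := by
  rw [prodPart_apply, prodPart_apply, hβ _ d _ (fun i => extInl_mem A (ha i)), map_zsmul]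

theorem diffPart_perm {n : ℕ} {σ : Equiv.Perm (Fin (n + 1))} {f β : OpFamily.{u, v} k n}
    (hβ : ∀ (A : DeltaAlg.{u, v} k) (d : Fin (n + 1) → ℤ) (a : Fin (n + 1) → A),
      (∀ i, a i ∈ A.deg (d i)) → β A a = (koszulSign σ d : ℤ) • f A (fun i => a (σ i)))
    (A : DeltaAlg.{u, v} k) (d : Fin (n + 1) → ℤ) (a : Fin (n + 1) → A)
    (ha : ∀ i, a i ∈ A.deg (d i)) :
    diffPart β A a = (koszulSign σ d : ℤ) • diffPart f A (fun i => a (σ i)) := by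
  rw [diffPart_apply, diffPart_apply, hβ _ d _ (fun i => extInl_mem A (ha i)), map_zsmul]

/-- The natural operations with one input are the linear combinations of the identity and `Δ`. -/
theorem IsNatural.unary {n q : ℕ} {β : OpFamily.{u, v} k n} (hβ : IsNatural n q β) (hn : n = 0) :
    ∃ c d : k, (∀ A a, β A a = c • a 0 + d • A.Δ (a 0)) ∧ (q ≠ 0 → c = 0) ∧ (q ≠ 1 → d = 0) := by
  induction hβ with
  | ident β hβ => exact ⟨1, 0, by simp [hβ], by simp, by simp⟩
  | differential β hβ => exact ⟨0, 1, by simp [hβ], by simp, by simp⟩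
  | product β hβ => exact absurd hn one_ne_zero
  | @comp n p l q r h i f g β hf hg hβ ihf ihg =>
    obtain rfl : p = 0 := by omega
    obtain ⟨c, d, h₁, hc, hd⟩ := ihf rfl
    obtain ⟨c', d', h₂, hc', hd'⟩ := ihg (by omega)
    refine ⟨c * c', c * d' + d * c', fun A a => ?_, fun hq => ?_, fun hq => ?_⟩
    · rw [hβ, h₁, insertArgs_unary, h₂]
      have : a ⟨((0 : Fin (l + 1)) : ℕ), by omega⟩ = a 0 := rfl
      simp only [this, smul_add, map_add, map_smul, A.Δ_sq, smul_zero, smul_smul, add_smul]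
      abel
    · by_cases hr : r = 0
      · rw [hc' (by omega), mul_zero]
      · rw [hc hr, zero_mul]
    · have h₃ : c * d' = 0 := by
        by_cases hr : r = 0
        · rw [hd' (by omega), mul_zero]
        · rw [hc hr, zero_mul]
      have h₄ : d * c' = 0 := by
        by_cases hr : r = 1
        · rw [hc' (by omega), mul_zero]
        · rw [hd hr, zero_mul]
      rw [h₃, h₄, add_zero]
  | @perm n q σ f β _ hβ ih =>
    subst hn
    obtain ⟨c, d, h₁, hc⟩ := ih rfl
    refine ⟨c, d, fun A a => ?_, hc⟩
    have : β A = f A := Mult.ext_homogeneous fun d a ha => by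
      have hσ : (fun i => a (σ i)) = a := funext fun i =>
        congrArg a (Subsingleton.elim (α := Fin 1) _ _)
      rw [hβ A d a ha, hσ]
      simp [koszulSign]
    rw [this, h₁]
  | zero n q => exact ⟨0, 0, by simp, by simp, by simp⟩
  | add f g _ _ ihf ihg =>
    obtain ⟨c, d, h₁, hc, hd⟩ := ihf hn
    obtain ⟨c', d', h₂, hc', hd'⟩ := ihg hn
    refine ⟨c + c', d + d', fun A a => ?_, fun hq => by rw [hc hq, hc' hq, add_zero],
      fun hq => by rw [hd hq, hd' hq, add_zero]⟩
    simp only [Pi.add_apply, add_apply, h₁, h₂, add_smul]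
    abel
  | smul e f _ ih =>
    obtain ⟨c, d, h₁, hc, hd⟩ := ih hn
    refine ⟨e * c, e * d, fun A a => ?_, fun hq => by rw [hc hq, mul_zero],
      fun hq => by rw [hd hq, mul_zero]⟩
    simp only [Pi.smul_apply, smul_apply, h₁, smul_add, smul_smul]

section UnaryComp

variable {n l q r : ℕ} {h : 0 + l = n} {i : Fin 1} {f : OpFamily.{u, v} k 0}
  {g : OpFamily.{u, v} k l} {β : OpFamily.{u, v} k n} {c d : k}

theorem prodPart_unary_comp (hf : ∀ A a, f A a = c • a 0 + d • A.Δ (a 0))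
    (hβ : ∀ A a, β A a = f A (insertArgs A h q (g A) i a)) (A : DeltaAlg.{u, v} k)
    (a : Fin (n + 1) → A) :
    prodPart β A a = c • prodPart g A (fun y => a ⟨y, by omega⟩) := by
  rw [prodPart_apply, hβ, hf, insertArgs_unary]
  simp [prodPart_apply]

theorem diffPart_unary_comp (hf : ∀ A a, f A a = c • a 0 + d • A.Δ (a 0))
    (hβ : ∀ A a, β A a = f A (insertArgs A h q (g A) i a)) (A : DeltaAlg.{u, v} k)
    (a : Fin (n + 1) → A) :
    diffPart β A a = c • diffPart g A (fun y => a ⟨y, by omega⟩) +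
      d • prodPart g A (fun y => a ⟨y, by omega⟩) := by
  rw [diffPart_apply, hβ, hf, insertArgs_unary]
  simp [prodPart_apply, diffPart_apply]

end UnaryComp

/-- A natural operation with at least two inputs is the sum of its product part and of `Δ` applied
to its differential part. -/
theorem IsNatural.eq_Δ_diffPart_add {n q : ℕ} {β : OpFamily.{u, v} k n} (hβ : IsNatural n q β)
    (hn : n ≠ 0) (A : DeltaAlg.{u, v} k) : ∀ a : Fin (n + 1) → A,
    β A a = A.Δ (diffPart β A a) + prodPart β A a := by
  induction hβ with
  | ident β hβ => exact absurd rfl hn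
  | differential β hβ => exact absurd rfl hn
  | product β hβ => intro a; simp [diffPart_apply, prodPart_apply, hβ]
  | @comp n p l q r h i f g β hf hg hβ ihf ihg =>
    intro a
    by_cases hp : p = 0
    · subst hp
      obtain ⟨c, d, h₁, -⟩ := hf.unary rfl
      rw [prodPart_unary_comp h₁ hβ, diffPart_unary_comp h₁ hβ, hβ, h₁, insertArgs_unary,
        ihg (by omega)]
      simp only [map_add, map_smul, A.Δ_sq, smul_add, zero_add]
      abel
    · rw [prodPart_comp hf hp hg hβ, diffPart_comp hf hp hg hβ, hβ, ihf hp]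
  | @perm n q σ f β _ hβ ih =>
    suffices h : β A = A.Δ.compMultilinearMap (diffPart β A) + prodPart β A from
      fun x => DFunLike.congr_fun h x
    refine Mult.ext_homogeneous fun d a ha => ?_
    rw [add_apply, LinearMap.compMultilinearMap_apply, prodPart_perm hβ A d a ha,
      diffPart_perm hβ A d a ha, hβ A d a ha, ih hn, map_zsmul, smul_add]
  | zero n q => intro a; simp [diffPart_apply, prodPart_apply]
  | @add n q f g _ _ ihf ihg =>
    intro a
    simp only [diffPart_apply, prodPart_apply, Pi.add_apply, add_apply, map_add] at ihf ihg ⊢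
    rw [ihf hn a, ihg hn a]
    abel
  | @smul n q c f _ ih =>
    intro a
    simp only [diffPart_apply, prodPart_apply, Pi.smul_apply, smul_apply, map_smul] at ih ⊢
    rw [ih hn a, smul_add]

theorem IsNatural.prodPart {n q : ℕ} {β : OpFamily.{u, v} k n} (hβ : IsNatural n q β)
    (hn : n ≠ 0) : IsNatural n q (prodPart β) := by
  induction hβ with
  | ident β hβ => exact absurd rfl hn
  | differential β hβ => exact absurd rfl hn
  | product β hβ =>
    exact .product _ fun A a => by simp [prodPart_apply, hβ]
  | @comp n p l q r h i f g β hf hg hβ ihf ihg =>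
    by_cases hp : p = 0
    · subst hp
      obtain rfl : l = n := by omega
      obtain ⟨c, d, h₁, hc, -⟩ := hf.unary rfl
      have key : NatBraces.prodPart β = c • NatBraces.prodPart g :=
        funext fun A => MultilinearMap.ext fun a => prodPart_unary_comp h₁ hβ A a
      rw [key]
      by_cases hr : r = 0
      · rw [hr, zero_add]
        exact .smul c _ (ihg hn)
      · rw [hc hr, zero_smul]
        exact .zero _ _
    · exact .comp h i _ g _ (ihf hp) hg fun A a => prodPart_comp hf hp hg hβ A a
  | @perm n q σ f β _ hβ ih => exact .perm σ _ _ (ih hn) (prodPart_perm hβ)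
  | zero n q =>
    have : NatBraces.prodPart (0 : OpFamily.{u, v} k n) = 0 :=
      funext fun A => MultilinearMap.ext fun a => by simp [prodPart_apply]
    rw [this]
    exact .zero _ _
  | @add n q f g _ _ ihf ihg =>
    have : NatBraces.prodPart (f + g) = NatBraces.prodPart f + NatBraces.prodPart g :=
      funext fun A => MultilinearMap.ext fun a => by simp [prodPart_apply]
    rw [this]
    exact .add _ _ (ihf hn) (ihg hn)
  | @smul n q c f _ ih =>
    have : NatBraces.prodPart (c • f) = c • NatBraces.prodPart f :=
      funext fun A => MultilinearMap.ext fun a => by simp [prodPart_apply]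
    rw [this]
    exact .smul _ _ (ih hn)

theorem diffPart_zero (n : ℕ) : diffPart (0 : OpFamily.{u, v} k n) = 0 :=
  funext fun A => MultilinearMap.ext fun a => by simp [diffPart_apply]

theorem diffPart_add {n : ℕ} (f g : OpFamily.{u, v} k n) :
    diffPart (f + g) = diffPart f + diffPart g :=
  funext fun A => MultilinearMap.ext fun a => by simp [diffPart_apply]

theorem diffPart_smul {n : ℕ} (c : k) (f : OpFamily.{u, v} k n) :
    diffPart (c • f) = c • diffPart f :=
  funext fun A => MultilinearMap.ext fun a => by simp [diffPart_apply]

/-- The differential part lowers the degree by one; in particular, it vanishes in degree `0`. -/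
theorem IsNatural.diffPart {n q : ℕ} {β : OpFamily.{u, v} k n} (hβ : IsNatural n q β)
    (hn : n ≠ 0) : (q = 0 → diffPart β = 0) ∧ ∀ q', q = q' + 1 → IsNatural n q' (diffPart β) := by
  induction hβ with
  | ident β hβ => exact absurd rfl hn
  | differential β hβ => exact absurd rfl hn
  | product β hβ =>
    exact ⟨fun _ => funext fun A => MultilinearMap.ext fun a => by simp [diffPart_apply, hβ],
      fun q' hq => by omega⟩
  | @comp n p l q r h i f g β hf hg hβ ihf ihg =>
    by_cases hp : p = 0
    · subst hp
      obtain rfl : l = n := by omega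
      obtain ⟨c, d, h₁, hc, hd⟩ := hf.unary rfl
      have key : NatBraces.diffPart β = c • NatBraces.diffPart g + d • NatBraces.prodPart g :=
        funext fun A => MultilinearMap.ext fun a => diffPart_unary_comp h₁ hβ A a
      rw [key]
      refine ⟨fun hq => ?_, fun q' hq => ?_⟩
      · rw [(ihg hn).1 (by omega), hd (by omega), smul_zero, zero_smul, add_zero]
      · refine .add _ _ ?_ ?_
        · by_cases hr : r = 0
          · exact .smul _ _ ((ihg hn).2 q' (by omega))
          · rw [hc hr, zero_smul]
            exact .zero _ _
        · by_cases hr : r = 1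
          · obtain rfl : q = q' := by omega
            exact .smul _ _ (hg.prodPart hn)
          · rw [hd hr, zero_smul]
            exact .zero _ _
    · have key : ∀ A a, NatBraces.diffPart β A a =
          NatBraces.diffPart f A (insertArgs A h q (g A) i a) := diffPart_comp hf hp hg hβ
      have h₀ : r = 0 → NatBraces.diffPart β = 0 := fun hr =>
        funext fun A => MultilinearMap.ext fun a => by rw [key, (ihf hp).1 hr]; rfl
      refine ⟨fun hq => h₀ (by omega), fun q' hq => ?_⟩
      rcases r with - | r
      · rw [h₀ rfl]
        exact .zero _ _
      · obtain rfl : q' = r + q := by omega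
        exact .comp h i _ g _ ((ihf hp).2 r rfl) hg key
  | @perm n q σ f β _ hβ ih =>
    refine ⟨fun hq => ?_, fun q' hq => .perm σ _ _ ((ih hn).2 q' hq) (diffPart_perm hβ)⟩
    refine funext fun A => Mult.ext_homogeneous fun d a ha => ?_
    rw [diffPart_perm hβ A d a ha, (ih hn).1 hq]
    simp
  | zero n q => rw [diffPart_zero]; exact ⟨fun _ => rfl, fun _ _ => .zero _ _⟩
  | @add n q f g _ _ ihf ihg =>
    rw [diffPart_add]
    exact ⟨fun hq => by rw [(ihf hn).1 hq, (ihg hn).1 hq, add_zero],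
      fun q' hq => .add _ _ ((ihf hn).2 q' hq) ((ihg hn).2 q' hq)⟩
  | @smul n q c f _ ih =>
    rw [diffPart_smul]
    exact ⟨fun hq => by rw [(ih hn).1 hq, smul_zero], fun q' hq => .smul _ _ ((ih hn).2 q' hq)⟩

/-! ### Composites and differentials of operations -/

/-- Updating one entry of `a` updates one argument of the composition, linearly in the new entry: an
argument before the input number `i`, this input itself, or an argument after it. -/
theorem exists_insertArgs_update (A : DeltaAlg.{u, v} k) {n p l : ℕ} [DecidableEq (Fin (n + 1))]
    (h : p + l = n) (q : ℕ) (g : Mult A l) (i : Fin (p + 1)) (a : Fin (n + 1) → A)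
    (j : Fin (n + 1)) : ∃ (x : Fin (p + 1)) (L : A →ₗ[k] A), ∀ y,
      insertArgs A h q g i (Function.update a j y) =
        Function.update (insertArgs A h q g i a) x (L y) := by
  obtain rfl := Subsingleton.elim ‹DecidableEq (Fin (n + 1))› (instDecidableEqFin _)
  rcases lt_or_ge (j : ℕ) i with hj | hj
  · refine ⟨⟨j, by omega⟩, parity A ^ q, fun y => funext fun x => ?_⟩
    rcases eq_or_ne x ⟨j, by omega⟩ with rfl | hx
    · rw [Function.update_self, insertArgs, if_pos (Fin.lt_def.2 hj), Function.update_self]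
    · have hx' : (x : ℕ) ≠ j := fun e => hx (Fin.ext e)
      rw [Function.update_of_ne hx]
      unfold insertArgs
      split_ifs with h₁ h₂
      · rw [Function.update_of_ne fun e => hx' (congrArg Fin.val e)]
      · refine congrArg _ (funext fun z => Function.update_of_ne (fun e => ?_) _ _)
        have := congrArg Fin.val e
        simp at this
        omega
      · refine Function.update_of_ne (fun e => ?_) _ _
        have := congrArg Fin.val e
        simp at this
        have := Fin.lt_def.not.1 h₁
        omega
  · rcases lt_or_ge (i + l : ℕ) j with hj' | hj'
    · refine ⟨⟨j - l, by omega⟩, LinearMap.id, fun y => funext fun x => ?_⟩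
      rcases eq_or_ne x ⟨j - l, by omega⟩ with rfl | hx
      · have e : (⟨j - l + l, by omega⟩ : Fin (n + 1)) = j := Fin.ext (by simp; omega)
        rw [Function.update_self, insertArgs, if_neg (Fin.lt_def.not.2 (by simp; omega)),
          if_neg (fun e => by have := congrArg Fin.val e; simp at this; omega)]
        simp only [e, Function.update_self]
        rfl
      · have hx' : (x : ℕ) ≠ j - l := fun e => hx (Fin.ext e)
        rw [Function.update_of_ne hx]
        unfold insertArgs
        split_ifs with h₁ h₂
        · rw [Function.update_of_ne fun e => ?_]
          have := congrArg Fin.val e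
          simp at this
          have := Fin.lt_def.1 h₁
          omega
        · refine congrArg _ (funext fun z => Function.update_of_ne (fun e => ?_) _ _)
          have := congrArg Fin.val e
          simp at this
          omega
        · refine Function.update_of_ne (fun e => ?_) _ _
          have := congrArg Fin.val e
          simp at this
          omega
    · refine ⟨i, g.toLinearMap (fun y => a ⟨i + y, by omega⟩) ⟨j - i, by omega⟩,
        fun y => funext fun x => ?_⟩
      rcases eq_or_ne x i with rfl | hx
      · rw [Function.update_self, insertArgs, if_neg (lt_irrefl _), if_pos rfl,
          MultilinearMap.toLinearMap_apply]
        refine congrArg _ (funext fun z => ?_)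
        by_cases hz : z = ⟨j - x, by omega⟩
        · subst hz
          have e : (⟨x + (j - x), by omega⟩ : Fin (n + 1)) = j := Fin.ext (by simp; omega)
          simp only [e, Function.update_self]
        · rw [Function.update_of_ne hz, Function.update_of_ne fun e => hz (Fin.ext ?_)]
          have := congrArg Fin.val e
          simp at this ⊢
          omega
      · rw [Function.update_of_ne hx]
        unfold insertArgs
        simp only [if_neg hx]
        split_ifs with h₁
        · rw [Function.update_of_ne fun e => ?_]
          have := congrArg Fin.val e
          simp at this
          have := Fin.lt_def.1 h₁
          omega
        · refine Function.update_of_ne (fun e => ?_) _ _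
          have := congrArg Fin.val e
          simp at this
          have := Fin.lt_def.not.1 h₁
          have : (x : ℕ) ≠ i := fun e => hx (Fin.ext e)
          omega

/-- The composite `f (id ⊗ ⋯ ⊗ id ⊗ g ⊗ id ⊗ ⋯ ⊗ id)`, with `g` of degree `q` plugged into the
input number `i` of `f`. -/
def compAt {A : DeltaAlg.{u, v} k} {n p l : ℕ} (h : p + l = n) (q : ℕ) (f : Mult A p)
    (g : Mult A l) (i : Fin (p + 1)) : Mult A n where
  toFun a := f (insertArgs A h q g i a)
  map_update_add' a j x y := by
    obtain ⟨z, L, hL⟩ := exists_insertArgs_update A h q g i a j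
    rw [hL, hL, hL, map_add, f.map_update_add]
  map_update_smul' a j c x := by
    obtain ⟨z, L, hL⟩ := exists_insertArgs_update A h q g i a j
    rw [hL, hL, map_smul, f.map_update_smul]

theorem compAt_apply {A : DeltaAlg.{u, v} k} {n p l : ℕ} (h : p + l = n) (q : ℕ) (f : Mult A p)
    (g : Mult A l) (i : Fin (p + 1)) (a : Fin (n + 1) → A) :
    compAt h q f g i a = f (insertArgs A h q g i a) := rfl

/-- The identity as a family of operations with one input. -/
def identOp : OpFamily.{u, v} k 0 := fun A =>
  MultilinearMap.ofSubsingleton k (A : Type v) (A : Type v) (0 : Fin 1) LinearMap.id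

/-- The differential as a family of operations with one input. -/
def deltaOp : OpFamily.{u, v} k 0 := fun A =>
  MultilinearMap.ofSubsingleton k (A : Type v) (A : Type v) (0 : Fin 1) A.Δ

/-- The multiplication as a family of operations with two inputs. -/
def mulOp : OpFamily.{u, v} k 1 := fun A =>
  { toFun := fun a => a 0 * a 1
    map_update_add' := fun a i x y => by fin_cases i <;> simp [add_mul, mul_add]
    map_update_smul' := fun a i c x => by
      fin_cases i <;> simp [smul_mul_assoc, mul_smul_comm] }

theorem isNatural_deltaOp : IsNatural 0 1 (deltaOp : OpFamily.{u, v} k 0) :=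
  .differential _ fun _ _ => rfl

theorem IsNatural.sum {n q : ℕ} {ι : Type*} (s : Finset ι) (f : ι → OpFamily.{u, v} k n)
    (h : ∀ i ∈ s, IsNatural n q (f i)) : IsNatural n q (∑ i ∈ s, f i) :=
  Finset.sum_induction f _ (fun _ _ => .add _ _) (.zero n q) h

theorem IsNatural.sub {n q : ℕ} {f g : OpFamily.{u, v} k n} (hf : IsNatural n q f)
    (hg : IsNatural n q g) : IsNatural n q (f - g) := by
  have h := IsNatural.add _ _ hf (.smul (-1) _ hg)
  rwa [neg_one_smul, ← sub_eq_add_neg] at h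

/-- The sum of the composites of an operation with `Δ` in one of its inputs. -/
def innerDiff {n : ℕ} (β : OpFamily.{u, v} k n) : OpFamily.{u, v} k n :=
  ∑ i : Fin (n + 1), fun A => compAt (Nat.add_zero n) 1 (β A) (deltaOp A) i

/-- The composite of an operation with `Δ`. -/
def outerDiff {n : ℕ} (β : OpFamily.{u, v} k n) : OpFamily.{u, v} k n := fun A =>
  A.Δ.compMultilinearMap (β A)

theorem innerDiff_apply {n : ℕ} (β : OpFamily.{u, v} k n) (A : DeltaAlg.{u, v} k)
    (a : Fin (n + 1) → A) :
    innerDiff β A a =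
      ∑ i : Fin (n + 1), β A (insertArgs A (Nat.add_zero n) 1 (deltaOp A) i a) := by
  simp only [innerDiff, Finset.sum_apply, sum_apply, compAt_apply]

theorem innerDiff_zero (n : ℕ) : innerDiff (0 : OpFamily.{u, v} k n) = 0 :=
  funext fun A => MultilinearMap.ext fun a => by simp [innerDiff_apply]

theorem IsNatural.innerDiff {n q : ℕ} {β : OpFamily.{u, v} k n} (hβ : IsNatural n q β) :
    IsNatural n (q + 1) (innerDiff β) :=
  .sum _ _ fun i _ => .comp (Nat.add_zero n) i β deltaOp _ hβ isNatural_deltaOp fun _ _ => rfl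

theorem IsNatural.outerDiff {n q : ℕ} {β : OpFamily.{u, v} k n} (hβ : IsNatural n q β) :
    IsNatural n (q + 1) (outerDiff β) := by
  rw [add_comm]
  refine .comp (Nat.zero_add n) 0 deltaOp β _ isNatural_deltaOp hβ fun A a => ?_
  change _ = A.Δ (insertArgs A (Nat.zero_add n) q (β A) 0 a 0)
  rw [insertArgs_unary]
  rfl

/-- Taking the differential part commutes with precomposition with `Δ`, as the latter does not
change the outermost operation of a composite with at least two inputs. -/
theorem diffPart_innerDiff {n q : ℕ} {β : OpFamily.{u, v} k n} (hβ : IsNatural n q β)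
    (hn : n ≠ 0) : diffPart (innerDiff β) = innerDiff (diffPart β) := by
  refine funext fun A => MultilinearMap.ext fun a => ?_
  rw [innerDiff_apply, diffPart_apply, innerDiff_apply, map_sum]
  refine Finset.sum_congr rfl fun i _ => ?_
  exact diffPart_comp (β := fun A => compAt (Nat.add_zero n) 1 (β A) (deltaOp A) i) hβ hn
    isNatural_deltaOp (fun _ _ => rfl) A a

theorem diffPart_outerDiff {n : ℕ} (β : OpFamily.{u, v} k n) :
    diffPart (outerDiff β) = prodPart β := rfl

theorem diffPart_sub {n : ℕ} (f g : OpFamily.{u, v} k n) :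
    diffPart (f - g) = diffPart f - diffPart g :=
  funext fun A => MultilinearMap.ext fun a => by simp [diffPart_apply]

theorem IsNatural.eq_zero {n q : ℕ} {β : OpFamily.{u, v} k n} (hβ : IsNatural n q β)
    (hn : n ≠ 0) (h₁ : NatBraces.diffPart β = 0) (h₂ : NatBraces.prodPart β = 0) : β = 0 :=
  funext fun A => MultilinearMap.ext fun a => by
    rw [hβ.eq_Δ_diffPart_add hn, h₁, h₂]
    simp

theorem IsNatural.prodPart_eq_self {n : ℕ} {β : OpFamily.{u, v} k n} (hβ : IsNatural n 0 β)
    (hn : n ≠ 0) : NatBraces.prodPart β = β :=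
  funext fun A => MultilinearMap.ext fun a => by
    rw [hβ.eq_Δ_diffPart_add hn, (hβ.diffPart hn).1 rfl]
    simp

/-! ### The recursion for the components of the automorphism -/

/-- The sum of the composites of the operations `φ p`, with `p < n`, with `m (n - p)` in one of
their inputs. -/
def lowerSum (m φ : ∀ n, OpFamily.{u, v} k n) (n : ℕ) : OpFamily.{u, v} k n :=
  ∑ p : Fin n, ∑ i : Fin (p + 1), fun A =>
    compAt (by omega : (p : ℕ) + (n - p) = n) 1 (φ p A) (m (n - p) A) i

theorem lowerSum_apply (m φ : ∀ n, OpFamily.{u, v} k n) (n : ℕ) (A : DeltaAlg.{u, v} k)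
    (a : Fin (n + 1) → A) :
    lowerSum m φ n A a = ∑ p : Fin n, ∑ i : Fin (p + 1),
      φ p A (insertArgs A (by omega : (p : ℕ) + (n - p) = n) 1 (m (n - p) A) i a) := by
  simp only [lowerSum, Finset.sum_apply, sum_apply, compAt_apply]

theorem lowerSum_congr (m : ∀ n, OpFamily.{u, v} k n) {φ φ' : ∀ n, OpFamily.{u, v} k n} {n : ℕ}
    (h : ∀ p < n, φ p = φ' p) : lowerSum m φ n = lowerSum m φ' n :=
  Finset.sum_congr rfl fun p _ => Finset.sum_congr rfl fun i _ => by rw [h p p.2]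

theorem IsNatural.lowerSum {m φ : ∀ n, OpFamily.{u, v} k n} {n q : ℕ}
    (hm : ∀ n, IsNatural n 1 (m n)) (hφ : ∀ p < n, IsNatural p q (φ p)) :
    IsNatural n (q + 1) (lowerSum m φ n) :=
  .sum _ _ fun p _ => .sum _ _ fun i _ =>
    .comp _ i _ _ _ (hφ p p.2) (hm _) fun _ _ => rfl

/-- The composite of the linear map with components `φ` with the coderivation with components `m`;
the summand in which `m 0 = Δ` is plugged into `φ n` is split off. -/
theorem ofMult_coder_word {m φ : ∀ n, OpFamily.{u, v} k n} (hm : m 0 = deltaOp)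
    (A : DeltaAlg.{u, v} k) (n : ℕ) (a : Fin (n + 1) → A) :
    ofMult (fun n => φ n A) (coder (ofMult fun n => m n A) (word A n a)) =
      (lowerSum m φ n + innerDiff (φ n)) A a := by
  simp only [coder_word, map_sum, ofMult_word]
  rw [sum_antidiagonal_fst n (fun p l h => ∑ i : Fin (p + 1),
    φ p A (insertArgs A h 1 (m l A) i a)), Fin.sum_univ_castSucc, Pi.add_apply, add_apply,
    lowerSum_apply, innerDiff_apply, ← hm]
  have congr_l : ∀ (l l' : ℕ) (h : n + l = n) (h' : n + l' = n),
      ∑ i : Fin (n + 1), φ n A (insertArgs A h 1 (m l A) i a) =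
        ∑ i : Fin (n + 1), φ n A (insertArgs A h' 1 (m l' A) i a) := by
    intro l l' h h'
    obtain rfl : l = l' := by omega
    rfl
  exact congrArg₂ _ rfl (congr_l _ _ _ _)

/-- The components of the automorphism which twists the trivial `A∞`-algebra to `m`. -/
def autComp (m : ∀ n, OpFamily.{u, v} k n) : ∀ n, OpFamily.{u, v} k n
  | 0 => identOp
  | n + 1 => diffPart (∑ p : Fin (n + 1), ∑ i : Fin (p + 1), fun A =>
      compAt (by omega : (p : ℕ) + (n + 1 - p) = n + 1) 1 (autComp m p A) (m (n + 1 - p) A) i)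

theorem autComp_zero (m : ∀ n, OpFamily.{u, v} k n) : autComp m 0 = identOp := by
  rw [autComp]

theorem autComp_of_ne_zero (m : ∀ n, OpFamily.{u, v} k n) {n : ℕ} (hn : n ≠ 0) :
    autComp m n = diffPart (lowerSum m (autComp m) n) := by
  obtain ⟨n, rfl⟩ := Nat.exists_eq_succ_of_ne_zero hn
  rw [autComp]
  rfl

theorem isNatural_autComp {m : ∀ n, OpFamily.{u, v} k n} (hm : ∀ n, IsNatural n 1 (m n)) (n : ℕ) :
    IsNatural n 0 (autComp m n) := by
  induction n using Nat.strong_induction_on with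
  | _ n ih =>
  rcases eq_or_ne n 0 with rfl | hn
  · rw [autComp_zero]
    exact .ident _ fun _ _ => rfl
  · rw [autComp_of_ne_zero m hn]
    exact ((IsNatural.lowerSum hm ih).diffPart hn).2 0 rfl

/-- The components of a natural automorphism which intertwines `m` with `Δ` satisfy the recursion
which defines `autComp`. -/
theorem eq_diffPart_lowerSum {m φ : ∀ n, OpFamily.{u, v} k n} {n : ℕ} (hn : n ≠ 0)
    (hφ : IsNatural n 0 (φ n)) (h : lowerSum m φ n + innerDiff (φ n) = outerDiff (φ n)) :
    φ n = diffPart (lowerSum m φ n) := by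
  have h₁ := congrArg diffPart h
  rw [diffPart_add, diffPart_innerDiff hφ hn, (hφ.diffPart hn).1 rfl, innerDiff_zero, add_zero,
    diffPart_outerDiff, hφ.prodPart_eq_self hn] at h₁
  exact h₁.symm

theorem eq_autComp {m φ : ∀ n, OpFamily.{u, v} k n} (h₀ : φ 0 = identOp)
    (hφ : ∀ n, IsNatural n 0 (φ n))
    (h : ∀ n, lowerSum m φ n + innerDiff (φ n) = outerDiff (φ n)) (n : ℕ) : φ n = autComp m n := by
  induction n using Nat.strong_induction_on with
  | _ n ih =>
  rcases eq_or_ne n 0 with rfl | hn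
  · rw [autComp_zero, h₀]
  · rw [autComp_of_ne_zero m hn, eq_diffPart_lowerSum hn (hφ n) (h n), lowerSum_congr m ih]

section Existence

variable {m : ∀ n, OpFamily.{u, v} k n}

/-- The coderivation of a natural `A∞`-algebra squares to zero. -/
theorem coder_comp_self (hm : IsNaturalAInfinity m) (A : DeltaAlg.{u, v} k) :
    coder (ofMult fun n => m n A) ∘ₗ coder (ofMult fun n => m n A) = 0 := by
  refine (isOddCoder_coder _).comp_self (fun t => ?_) fun t => ?_
  · rw [proj_coder, proj_coder]
    suffices h : ofMult (fun n => m n A) ∘ₗ parityTc A = -(parity A ∘ₗ ofMult fun n => m n A) from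
      LinearMap.congr_fun h t
    refine Tc.hom_ext fun n a => ?_
    rw [LinearMap.comp_apply, parityTc_word, ofMult_word, (hm.natural n).parity_apply]
    simp [ofMult_word]
  · rw [proj_coder]
    suffices h : ofMult (fun n => m n A) ∘ₗ coder (ofMult fun n => m n A) = 0 from
      LinearMap.congr_fun h t
    refine Tc.hom_ext fun n a => ?_
    rw [LinearMap.comp_apply, coder_word]
    simp only [map_sum, ofMult_word]
    exact (hm.aInfinity A).axioms n a

/-- The defect of the intertwining relation for `φ`. -/
def defect (m φ : ∀ n, OpFamily.{u, v} k n) (n : ℕ) : OpFamily.{u, v} k n :=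
  lowerSum m φ n + innerDiff (φ n) - outerDiff (φ n)

/-- The first nonvanishing defect of the intertwining relation is a cocycle, as both `Δ` and the
coderivation given by `m` square to zero. -/
theorem outerDiff_defect_add (hm : IsNaturalAInfinity m) (hm₀ : m 0 = deltaOp)
    (φ : ∀ n, OpFamily.{u, v} k n) {n : ℕ} (h : ∀ p < n, defect m φ p = 0) :
    outerDiff (defect m φ n) + innerDiff (defect m φ n) = 0 := by
  refine funext fun A => MultilinearMap.ext fun a => ?_
  set M := coder (ofMult fun n => m n A) with hM
  set F := ofMult fun n => φ n A with hF
  have hdef : ofMult (fun n => defect m φ n A) = F ∘ₗ M - A.Δ ∘ₗ F := by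
    refine Tc.hom_ext fun n a => ?_
    rw [ofMult_word, LinearMap.sub_apply, LinearMap.comp_apply, LinearMap.comp_apply,
      ofMult_coder_word hm₀, hF, ofMult_word]
    rfl
  have h₁ := ofMult_coder_word (φ := defect m φ) hm₀ A n a
  have h₂ : lowerSum m (defect m φ) n = 0 := by
    rw [lowerSum_congr m (φ' := fun _ => 0) h]
    exact funext fun A => MultilinearMap.ext fun a => by simp [lowerSum_apply]
  have h₃ : M (M (word A n a)) = 0 := LinearMap.congr_fun (coder_comp_self hm A) _
  have h₄ : defect m φ n A a = F (M (word A n a)) - A.Δ (F (word A n a)) := by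
    rw [← ofMult_word (fun n => defect m φ n A), hdef]
    rfl
  rw [h₂, zero_add, hdef, LinearMap.sub_apply, LinearMap.comp_apply, LinearMap.comp_apply, ← hM,
    h₃, map_zero, zero_sub] at h₁
  rw [Pi.add_apply, add_apply, ← h₁]
  change A.Δ (defect m φ n A a) + _ = 0
  rw [h₄, map_sub, A.Δ_sq]
  simp

/-- The operations `autComp m` intertwine `m` with `Δ`. -/
theorem defect_autComp (hm : IsNaturalAInfinity m) (hm₀ : m 0 = deltaOp) (n : ℕ) :
    defect m (autComp m) n = 0 := by
  induction n using Nat.strong_induction_on with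
  | _ n ih =>
  rcases eq_or_ne n 0 with rfl | hn
  · refine funext fun A => MultilinearMap.ext fun a => ?_
    rw [defect, autComp_zero]
    simp only [Pi.sub_apply, Pi.add_apply, sub_apply, add_apply, lowerSum_apply, innerDiff_apply,
      Finset.univ_eq_empty, Finset.sum_empty, zero_add]
    exact (congrArg (· - A.Δ (a 0)) (Fin.sum_univ_one _)).trans (sub_self (A.Δ (a 0)))
  · have hφ := isNatural_autComp hm.natural n
    have hd : IsNatural n 1 (defect m (autComp m) n) :=
      (IsNatural.add _ _ (IsNatural.lowerSum hm.natural fun p _ =>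
        isNatural_autComp hm.natural p) hφ.innerDiff).sub hφ.outerDiff
    -- the recursion for `autComp` kills the differential part of the defect, the cocycle condition
    -- the product part
    have h₁ : diffPart (defect m (autComp m) n) = 0 := by
      rw [defect, diffPart_sub, diffPart_add, ← autComp_of_ne_zero m hn,
        diffPart_innerDiff hφ hn, (hφ.diffPart hn).1 rfl, innerDiff_zero, diffPart_outerDiff,
        hφ.prodPart_eq_self hn, add_zero, sub_self]
    have h₂ := congrArg diffPart (outerDiff_defect_add hm hm₀ (autComp m) ih)
    rw [diffPart_add, diffPart_outerDiff, diffPart_innerDiff hd hn, h₁, innerDiff_zero, add_zero,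
      diffPart_zero] at h₂
    exact hd.eq_zero hn h₁ h₂

end Existence

/-! ### The twisting automorphism -/

/-- A natural automorphism twists the trivial `A∞`-algebra to `m` if and only if its components
intertwine `m` with `Δ`. -/
theorem IsNaturalAut.twist_iff {m : ∀ n, OpFamily.{u, v} k n} (hm₀ : m 0 = deltaOp)
    {φ : ∀ A : DeltaAlg.{u, v} k, Tc A ≃ₗ[k] Tc A} (hφ : IsNaturalAut φ) :
    (∀ A n, m n A = component (twist (φ A) (trivialCoder A)) n) ↔
      ∀ n, lowerSum m (fun n A => component (φ A).toLinearMap n) n +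
          innerDiff (fun A => component (φ A).toLinearMap n) =
        outerDiff (fun A => component (φ A).toLinearMap n) := by
  have key := fun A => NatBraces.twist_iff (φ A) (hφ.coalg A)
    (fun n a => by simpa using (hφ.natural n).parity_apply A a) (fun n => m n A)
  have hsum := fun A n a =>
    ofMult_coder_word (φ := fun n A => component (φ A).toLinearMap n) hm₀ A n a
  constructor
  · intro h n
    refine funext fun A => MultilinearMap.ext fun a => ?_
    rw [← hsum]
    exact (key A).1 (h A) n a
  · intro h A
    refine (key A).2 fun n a => ?_
    have := hsum A n a
    rw [h] at this
    exact this

theorem IsNaturalAut.component_zero_eq {φ : ∀ A : DeltaAlg.{u, v} k, Tc A ≃ₗ[k] Tc A}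
    (hφ : IsNaturalAut φ) :
    (fun A => component (φ A).toLinearMap 0 : OpFamily.{u, v} k 0) = identOp :=
  funext fun A => MultilinearMap.ext fun a => hφ.component_zero A a

/-- An automorphism of the tensor coalgebra with prescribed components. -/
theorem exists_naturalAut {φ : ∀ n, OpFamily.{u, v} k n} (h₀ : φ 0 = identOp)
    (hφ : ∀ n, IsNatural n 0 (φ n)) :
    ∃ Φ : ∀ A : DeltaAlg.{u, v} k, Tc A ≃ₗ[k] Tc A, IsNaturalAut Φ ∧
      ∀ n, (fun A => component (Φ A).toLinearMap n) = φ n := by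
  have hF : ∀ A a, ofMult (fun n => φ n A) (single A a) = a := fun A a => by
    rw [single_apply, ofMult_word, h₀]
    rfl
  choose Φ hΦ using fun A => exists_equiv_coext (hF A)
  have hc : ∀ n, (fun A => component (Φ A).toLinearMap n) = φ n := fun n =>
    funext fun A => MultilinearMap.ext fun a => by
      rw [hΦ, component_apply, proj_coext, ofMult_word]
  refine ⟨Φ, ⟨fun A => ?_, fun n => ?_, fun A a => ?_⟩, hc⟩
  · rw [hΦ, deconc_coext]
  · rw [hc]
    exact hφ n
  · rw [show component (Φ A).toLinearMap 0 = φ 0 A from congrFun (hc 0) A, h₀]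
    rfl

theorem naturalAut_ext {φ ψ : ∀ A : DeltaAlg.{u, v} k, Tc A ≃ₗ[k] Tc A} (hφ : IsNaturalAut φ)
    (hψ : IsNaturalAut ψ)
    (h : ∀ n, (fun A => component (φ A).toLinearMap n : OpFamily.{u, v} k n) =
      fun A => component (ψ A).toLinearMap n) : φ = ψ := by
  refine funext fun A => LinearEquiv.toLinearMap_injective ?_
  rw [coalgHom_eq_coext (hφ.coalg A), coalgHom_eq_coext (hψ.coalg A), ← ofMult_component,
    ← ofMult_component]
  exact congrArg (fun F => coext (ofMult F)) (funext fun n => congrFun (h n) A)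

/-- In arity two, the only composite of lower order is that of the identity with `m 1`. -/
theorem lowerSum_one {m φ : ∀ n, OpFamily.{u, v} k n} (h₀ : φ 0 = identOp) :
    lowerSum m φ 1 = m 1 := by
  refine funext fun A => MultilinearMap.ext fun a => ?_
  rw [lowerSum_apply, Fin.sum_univ_one]
  change ∑ i : Fin 1, φ 0 A (insertArgs A (l := 1) rfl 1 (m 1 A) i a) = _
  rw [Fin.sum_univ_one, h₀]
  change insertArgs A (l := 1) rfl 1 (m 1 A) 0 a 0 = _
  rw [insertArgs_unary]

theorem innerDiff_two_apply (β : OpFamily.{u, v} k 1) (A : DeltaAlg.{u, v} k) (a b : A) :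
    innerDiff β A ![a, b] = β A ![A.Δ a, b] + β A ![parity A a, A.Δ b] := by
  rw [innerDiff_apply, Fin.sum_univ_two]
  refine congrArg₂ _ (congrArg _ (funext fun x => ?_)) (congrArg _ (funext fun x => ?_))
  · fin_cases x <;> simp [insertArgs, deltaOp]
  · fin_cases x <;> simp [insertArgs, deltaOp]

end NatBraces

end

theorem mainTheorem1 {k : Type u} [Field k] [CharZero k]
    (m : ∀ n : ℕ, NatBraces.OpFamily.{u, v} k n) (hm : NatBraces.IsNaturalAInfinity m)
    (hm₁ : ∀ (A : NatBraces.DeltaAlg.{u, v} k) (a : Fin 1 → A), m 0 A a = A.Δ (a 0)) :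
    (∃! φ : ∀ A : NatBraces.DeltaAlg.{u, v} k, NatBraces.Tc A ≃ₗ[k] NatBraces.Tc A,
      NatBraces.IsNaturalAut φ ∧
        ∀ A n, m n A = NatBraces.component (NatBraces.twist (φ A) (NatBraces.trivialCoder A)) n) ∧
    ∀ φ : ∀ A : NatBraces.DeltaAlg.{u, v} k, NatBraces.Tc A ≃ₗ[k] NatBraces.Tc A,
      NatBraces.IsNaturalAut φ →
      (∀ A n, m n A =
        NatBraces.component (NatBraces.twist (φ A) (NatBraces.trivialCoder A)) n) →
      ((∀ (A : NatBraces.DeltaAlg.{u, v} k) (d : ℤ) (a b : A), a ∈ A.deg d →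
          m 1 A ![a, b] = A.Δ (a * b) - (d.negOnePow : ℤ) • (a * A.Δ b) - A.Δ a * b) ↔
        ∀ (A : NatBraces.DeltaAlg.{u, v} k) (a b : A),
          NatBraces.component (φ A).toLinearMap 1 ![a, b] = a * b) := by
  have hm₀ : m 0 = NatBraces.deltaOp := funext fun A => MultilinearMap.ext fun a => hm₁ A a
  refine ⟨?_, fun φ hφ htw => ?_⟩
  · obtain ⟨Φ, hΦ, hc⟩ := NatBraces.exists_naturalAut (NatBraces.autComp_zero m)
      (NatBraces.isNatural_autComp hm.natural)
    refine ⟨Φ, ⟨hΦ, (hΦ.twist_iff hm₀).2 fun n => ?_⟩, fun ψ ⟨hψ, htw⟩ => ?_⟩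
    · have := NatBraces.defect_autComp hm hm₀ n
      rw [← funext hc] at this
      exact sub_eq_zero.1 this
    · refine NatBraces.naturalAut_ext hψ hΦ fun n => ?_
      rw [hc]
      exact NatBraces.eq_autComp (φ := fun n A => NatBraces.component (ψ A).toLinearMap n)
        hψ.component_zero_eq hψ.natural ((hψ.twist_iff hm₀).1 htw) n
  · have heq := (hφ.twist_iff hm₀).1 htw 1
    have hlow : NatBraces.lowerSum m
        (fun n A => NatBraces.component (φ A).toLinearMap n) 1 = m 1 :=
      NatBraces.lowerSum_one hφ.component_zero_eq
    constructor
    · intro h A a b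
      have hmul : NatBraces.IsNatural 1 0 (NatBraces.mulOp : NatBraces.OpFamily.{u, v} k 1) :=
        .product _ fun _ _ => rfl
      -- the hypothesis says that `m 1` is the coboundary of the multiplication
      have h₁ : m 1 = NatBraces.outerDiff NatBraces.mulOp -
          NatBraces.innerDiff NatBraces.mulOp := by
        refine funext fun A => NatBraces.Mult.ext_homogeneous fun d a ha => ?_
        obtain ⟨a, b, rfl⟩ : ∃ x y : A, a = ![x, y] :=
          ⟨a 0, a 1, funext fun i => by fin_cases i <;> rfl⟩
        have ha₀ : a ∈ A.deg (d 0) := ha 0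
        rw [h A (d 0) a b ha₀, Pi.sub_apply, sub_apply, NatBraces.innerDiff_two_apply,
          NatBraces.parity_of_mem A ha₀]
        change _ = A.Δ (a * b) - (A.Δ a * b + ((d 0).negOnePow : ℤ) • a * A.Δ b)
        rw [smul_mul_assoc]
        abel
      have h₂ := NatBraces.eq_diffPart_lowerSum
        (φ := fun n A => NatBraces.component (φ A).toLinearMap n) one_ne_zero (hφ.natural 1) heq
      rw [hlow, h₁, NatBraces.diffPart_sub, NatBraces.diffPart_outerDiff,
        NatBraces.diffPart_innerDiff hmul one_ne_zero, (hmul.diffPart one_ne_zero).1 rfl,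
        NatBraces.innerDiff_zero, sub_zero, hmul.prodPart_eq_self one_ne_zero] at h₂
      exact DFunLike.congr_fun (congrFun h₂ A) ![a, b]
    · intro h A d a b ha
      have h₁ := DFunLike.congr_fun (congrFun heq A) ![a, b]
      rw [hlow, Pi.add_apply, add_apply, NatBraces.innerDiff_two_apply] at h₁
      change _ + (NatBraces.component (φ A).toLinearMap 1 _ +
        NatBraces.component (φ A).toLinearMap 1 _) =
        A.Δ (NatBraces.component (φ A).toLinearMap 1 _) at h₁
      rw [h, h, h, NatBraces.parity_of_mem A ha, smul_mul_assoc] at h₁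
      rw [← h₁]
      abel
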